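/- Let $L_p$, $1\le p\le\infty$, be the space of $2\pi$-periodic real functions with the norm $\|f\|_p=\big(\int_0^{2\pi}|f(t)|^p\,dt\big)^{1/p}$ for $p<\infty$ and $\|f\|_\infty=\operatorname{ess\,sup}_t|f(t)|$, and let $\|f\|_C=\sup_{t\in\mathbb R}|f(t)|$. For $\alpha>0$, $0<r<1$, $\beta\in\mathbb R$, let $C^{\alpha,r}_{\beta,p}$ be the class of $2\pi$-periodic functions $f$ that can be written, for all $x\in\mathbb R$, as $$f(x)=\frac{a_0}{2}+\frac1\pi\int_{-\pi}^{\pi}P_{\alpha,r,\beta}(x-t)\,\varphi(t)\,dt,\qquad P_{\alpha,r,\beta}(t)=\sum_{k=1}^{\infty}e^{-\alpha k^r}\cos\Big(kt-\frac{\beta\pi}{2}\Big),$$ with $a_0\in\mathbb R$ and $\varphi\in L_p$, $\|\varphi\|_p\le1$, $\int_{-\pi}^{\pi}\varphi(t)\,dt=0$. Put $$\mathcal E_n(C^{\alpha,r}_{\beta,p})_C=\sup_{f\in C^{\alpha,r}_{\beta,p}}\|f-S_{n-1}(f)\|_C,$$ where $S_{n-1}(f)$ is the partial Fourier sum of $f$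 of order $n-1$. For $v>0$ and $1\le s\le\infty$ let $J_s(v)=\big\|(t^2+1)^{-1/2}\big\|_{L_s[0,v]}$. Let $\chi(p)=p$ for $1\le p<\infty$ and $\chi(\infty)=1$, and let $n_0(\alpha,r,p)$ be the smallest positive integer $n$ such that $$\frac{1}{\alpha r}\frac1{n^r}+\frac{\alpha r\,\chi(p)}{n^{1-r}}\le\begin{cases}\frac1{14},&p=1,\\ \frac{1}{(3\pi)^3}\cdot\frac{p-1}{p},&1<p<\infty,\\ \frac1{(3\pi)^3},&p=\infty.\end{cases}$$ **Theorem 1.** Let $0<r<1$, $1\le p\le\infty$, $\frac1p+\frac1{p'}=1$, $\alpha>0$ and $\beta\in\mathbb R$. Then for every integer $n\ge n_0(\alpha,r,p)$ the quantity $\mathcal E_n(C^{\alpha,r}_{\beta,p})_C$ is finite and $$\mathcal E_n(C^{\alpha,r}_{\beta,p})_C=e^{-\alpha n^r}n^{\frac{1-r}{p}}\bigg(\frac{\|\cos t\|_{p'}}{\pi^{1+\frac1{p'}}(\alpha r)^{\frac1p}}\,J_{p'}\Big(\frac{\pi n^{1-r}}{\alpha r}\Big)+\gamma\Big(\frac{1}{(\alpha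 r)^{1+\frac1p}}\,J_{p'}\Big(\frac{\pi n^{1-r}}{\alpha r}\Big)\frac1{n^r}+\frac{1}{n^{\frac{1-r}{p}}}\Big)\bigg)$$ for some real number $\gamma=\gamma_{n,p}(\alpha,r,\beta)$ with $|\gamma|\le(14\pi)^2$. -/

import Mathlib

open MeasureTheory
open scoped ENNReal

noncomputable section

namespace FourierPoisson

/-- The generalized Poisson kernel
`P_{α,r,β}(t) = ∑_{k ≥ 1} exp (-α k ^ r) cos (k t - β π / 2)`; the series converges absolutely
for `α, r > 0`. -/
def poissonKernel (α r β t : ℝ) : ℝ :=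
  ∑' k : ℕ, Real.exp (-α * ((k + 1 : ℕ) : ℝ) ^ r) *
    Real.cos (((k + 1 : ℕ) : ℝ) * t - β * Real.pi / 2)

/-- The (extended) `L_p` norm, `1 ≤ p ≤ ∞`, of a `2π`-periodic function over one period, with
respect to Lebesgue measure `dt` (not normalized); for `p = ∞` it is the essential supremum of
the modulus. By periodicity the choice of the period interval `(-π, π]` is immaterial. -/
def periodNorm (p : ℝ≥0∞) (f : ℝ → ℝ) : ℝ≥0∞ :=
  eLpNorm f p (volume.restrict (Set.Ioc (-Real.pi) Real.pi))

/-- `B_p^0`: the `2π`-periodic functions in the unit ball of `L_p` that are orthogonal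
to constants. -/
def unitBallZero (p : ℝ≥0∞) : Set (ℝ → ℝ) :=
  {φ | Function.Periodic φ (2 * Real.pi) ∧
    AEStronglyMeasurable φ (volume.restrict (Set.Ioc (-Real.pi) Real.pi)) ∧
    periodNorm p φ ≤ 1 ∧ ∫ t in (-Real.pi)..Real.pi, φ t = 0}

/-- The class `C^{α,r}_{β,p}` of generalized Poisson integrals: `2π`-periodic functions of the form
`f(x) = a₀ / 2 + (1 / π) ∫_{-π}^{π} P_{α,r,β}(x - t) φ(t) dt` for all real `x`,
with `a₀` real and `φ ∈ B_p^0`. -/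
def poissonClass (α r β : ℝ) (p : ℝ≥0∞) : Set (ℝ → ℝ) :=
  {f | Function.Periodic f (2 * Real.pi) ∧ ∃ a₀ : ℝ, ∃ φ ∈ unitBallZero p, ∀ x : ℝ,
    f x = a₀ / 2 + 1 / Real.pi *
      ∫ t in (-Real.pi)..Real.pi, poissonKernel α r β (x - t) * φ t}

/-- The cosine Fourier coefficient `a_k(f) = (1 / π) ∫_{-π}^{π} f(t) cos (k t) dt`. -/
def cosCoeff (f : ℝ → ℝ) (k : ℕ) : ℝ :=
  1 / Real.pi * ∫ t in (-Real.pi)..Real.pi, f t * Real.cos (k * t)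

/-- The sine Fourier coefficient `b_k(f) = (1 / π) ∫_{-π}^{π} f(t) sin (k t) dt`. -/
def sinCoeff (f : ℝ → ℝ) (k : ℕ) : ℝ :=
  1 / Real.pi * ∫ t in (-Real.pi)..Real.pi, f t * Real.sin (k * t)

/-- The partial Fourier sum `S_m(f; x)` of order `m`. -/
def fourierSum (f : ℝ → ℝ) (m : ℕ) (x : ℝ) : ℝ :=
  cosCoeff f 0 / 2 +
    ∑ k ∈ Finset.Icc 1 m, (cosCoeff f k * Real.cos (k * x) + sinCoeff f k * Real.sin (k * x))

/-- The uniform norm, with values in `[0, ∞]`. -/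
def uniformNorm (f : ℝ → ℝ) : ℝ≥0∞ :=
  ⨆ x : ℝ, ‖f x‖ₑ

/-- `E_n(C^{α,r}_{β,p})_C`: the supremum over `f` in the class of the uniform norm of
`f - S_{n-1}(f)`, for `n ≥ 1`, with values in `[0, ∞]`. -/
def fourierDeviation (α r β : ℝ) (p : ℝ≥0∞) (n : ℕ) : ℝ≥0∞ :=
  ⨆ f ∈ poissonClass α r β p, uniformNorm (fun x => f x - fourierSum f (n - 1) x)

/-- `J_s(v)`: the `L_s` norm of `1 / √(t² + 1)` on the interval `[0, v]`. -/
def J (s : ℝ≥0∞) (v : ℝ) : ℝ :=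
  (eLpNorm (fun t : ℝ => 1 / Real.sqrt (t ^ 2 + 1)) s
    (volume.restrict (Set.Icc 0 v))).toReal

/-- `χ(p) = p` for `p < ∞` and `χ(∞) = 1`. -/
def chi (p : ℝ≥0∞) : ℝ :=
  if p = ∞ then 1 else p.toReal

/-- The right-hand side of the inequality that defines `n₀(α, r, p)`. -/
def threshold (p : ℝ≥0∞) : ℝ :=
  if p = 1 then 1 / 14
  else if p = ∞ then 1 / (3 * Real.pi) ^ 3
  else 1 / (3 * Real.pi) ^ 3 * ((p.toReal - 1) / p.toReal)

/-- `n₀(α, r, p)`: the smallest positive integer `n` with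
`1 / (α r n ^ r) + α r χ(p) / n ^ (1 - r) ≤ threshold p`. -/
def n₀ (α r : ℝ) (p : ℝ≥0∞) : ℕ :=
  sInf {n : ℕ | 1 ≤ n ∧
    1 / (α * r) * (1 / (n : ℝ) ^ r) + α * r * chi p / (n : ℝ) ^ (1 - r) ≤ threshold p}

end FourierPoisson

end

/-! Write q = p', A = α r n ^ r and a = A / n. Convolution with the Poisson kernel turns f -
S_{n-1}(f) into (1/π) times the convolution of φ with the tail of the kernel. Hölder bounds the
deviation by (1/π) times the L_q norm of that tail. Conversely a near-extremal ψ exists in the unit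
ball of L_p, but φ must have mean zero. Taking φ = (ψ - ψ(· + π/n)) / 2 repairs this at small cost,
because the tail almost changes sign under a shift by π/n (`fourierDeviation_le`,
`le_toReal_fourierDeviation`). The problem becomes that of the norm of the tail.

The tail is e^{-α n^r} Re(e^{i(nt+σ)} R(t)), with R the normalized remainder series. Three facts
give its norm.

R is close to 1 / (1 - e^{-a+it}), since consecutive coefficients of R have ratio at least e^{-a}
and the defects have a small sum (`norm_one_sub_exp_mul_remainderSeries_sub_one_le`). That in turn
is within 6 of 1 / (a - it).

R changes little under shifts of size at most π/n, while such a shift moves the phase nt by up to π.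
The norm of Re(e^{i(nt+σ)} R) is therefore almost independent of σ, and averaging its q-th power
over σ separates a factor ‖cos‖_q / (2π)^{1/q} from ‖R‖_q (`abs_normOn_phasePart_sub_le`).

The norm of 1 / (a - it) scales exactly to 2^{1/q} a^{1/q-1} J_q(π/a) (`normOn_cauchyKernel`).

All errors are O(1) + O(1/A) times the main norm, which is the shape of the claimed remainder. From
n ≥ n₀ only A ≥ 14 and a ≤ 1/14 are needed. -/

namespace FourierPoisson

/-! ### Coefficients of the remainder series and comparison with a geometric series -/

/-- The ratio `exp (-α (n + j) ^ r) / exp (-α n ^ r)`. -/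
noncomputable def coeffRatio (α r : ℝ) (n j : ℕ) : ℝ :=
  Real.exp (-α * (((n + j : ℕ) : ℝ) ^ r - (n : ℝ) ^ r))

/-- The normalized remainder series `∑ exp (-α ((n + j) ^ r - n ^ r)) exp (i j t)`. -/
noncomputable def remainderSeries (α r : ℝ) (n : ℕ) (t : ℝ) : ℂ :=
  ∑' j : ℕ, (coeffRatio α r n j : ℂ) * Complex.exp (((j : ℝ) * t : ℝ) * Complex.I)

/-- The geometric series `∑ exp (-a j) exp (i j t)` in closed form. -/
noncomputable def geomKernel (a t : ℝ) : ℂ := (1 - Complex.exp ((-a : ℝ) + t * Complex.I))⁻¹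

/-- The kernel `1 / (a - i t)`. -/
noncomputable def cauchyKernel (a t : ℝ) : ℂ := ((a : ℂ) - t * Complex.I)⁻¹

lemma coeffRatio_pos (α r : ℝ) (n j : ℕ) : 0 < coeffRatio α r n j := Real.exp_pos _

lemma coeffRatio_zero (α r : ℝ) (n : ℕ) : coeffRatio α r n 0 = 1 := by simp [coeffRatio]

/-- With x = log((n + j) / n), the inequality e^{rx} ≥ 1 + rx gives (n + j)^r - n^r ≥ r n^r x. A
power decay of exponent A is enough to sum the coefficients. -/
lemma coeffRatio_le_rpow {α r : ℝ} (hα : 0 < α) {n : ℕ} (hn : 1 ≤ n) (j : ℕ) :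
    coeffRatio α r n j ≤ ((n : ℝ) / ((n + j : ℕ) : ℝ)) ^ (α * r * (n : ℝ) ^ r) := by
  have hn0 : (0 : ℝ) < n := by exact_mod_cast hn
  have hm0 : (0 : ℝ) < ((n + j : ℕ) : ℝ) := by positivity
  rw [Real.rpow_def_of_pos (div_pos hn0 hm0), coeffRatio]
  apply Real.exp_le_exp.2
  have hx : ((n + j : ℕ) : ℝ) ^ r = (n : ℝ) ^ r * Real.exp (r * -Real.log ((n : ℝ) / ((n + j : ℕ) : ℝ))) := by
    rw [Real.log_div hn0.ne' hm0.ne', Real.rpow_def_of_pos hn0, Real.rpow_def_of_pos hm0,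
      ← Real.exp_add]
    congr 1; ring
  rw [hx]
  have h1 := Real.add_one_le_exp (r * -Real.log ((n : ℝ) / ((n + j : ℕ) : ℝ)))
  have h2 : 0 < α * (n : ℝ) ^ r := by positivity
  nlinarith [mul_le_mul_of_nonneg_left h1 h2.le]

/-- A discrete form of comparison with the integral of x^{-A}. Bernoulli's inequality for the
exponent A - 1 ≥ 1 makes the right side telescope over j. -/
lemma rpow_ratio_le_telescope {A : ℝ} (hA : 2 ≤ A) {n : ℕ} (hn : 1 ≤ n) (j : ℕ) :
    ((n : ℝ) / ((n + (j + 1) : ℕ) : ℝ)) ^ A ≤ n / (A - 1) *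
      (((n : ℝ) / ((n + j : ℕ) : ℝ)) ^ (A - 1) - ((n : ℝ) / ((n + (j + 1) : ℕ) : ℝ)) ^ (A - 1)) := by
  have hn0 : (0 : ℝ) < n := by exact_mod_cast hn
  set m : ℝ := ((n + j : ℕ) : ℝ) with hm
  have hm0 : (0 : ℝ) < m := by rw [hm]; positivity
  have hm1 : ((n + (j + 1) : ℕ) : ℝ) = m + 1 := by rw [hm]; push_cast; ring
  rw [hm1]
  have hB : 1 + (A - 1) * (1 / m) ≤ (1 + 1 / m) ^ (A - 1) :=
    one_add_mul_self_le_rpow_one_add (by linarith [one_div_pos.2 hm0]) (by linarith)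
  have e1 : (n : ℝ) / m = n / (m + 1) * (1 + 1 / m) := by field_simp
  have e2 : ((n : ℝ) / m) ^ (A - 1) = (n / (m + 1)) ^ (A - 1) * (1 + 1 / m) ^ (A - 1) := by
    rw [e1, Real.mul_rpow (by positivity) (by positivity)]
  have e3 : ((n : ℝ) / (m + 1)) ^ A = (n / (m + 1)) ^ (A - 1) * (n / (m + 1)) := by
    rw [← Real.rpow_add_one (by positivity)]; congr 1; ring
  rw [e2, e3]
  have hA1 : 0 < A - 1 := by linarith
  set y := ((n : ℝ) / (m + 1)) ^ (A - 1) with hy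
  have hy0 : 0 < y := by rw [hy]; positivity
  have h3 : (A - 1) / (m + 1) ≤ (1 + 1 / m) ^ (A - 1) - 1 := by
    have : (A - 1) / (m + 1) ≤ (A - 1) * (1 / m) := by
      rw [mul_one_div]; gcongr; linarith
    linarith
  calc y * (n / (m + 1)) = n / (A - 1) * (y * ((A - 1) / (m + 1))) := by field_simp
    _ ≤ n / (A - 1) * (y * ((1 + 1 / m) ^ (A - 1) - 1)) := by gcongr
    _ = _ := by ring

lemma sum_coeffRatio_le {α r : ℝ} (hα : 0 < α) {n : ℕ} (hn : 1 ≤ n)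
    (hA : 2 ≤ α * r * (n : ℝ) ^ r) (N : ℕ) :
    ∑ j ∈ Finset.range N, coeffRatio α r n j ≤ 1 + n / (α * r * (n : ℝ) ^ r - 1) := by
  set A := α * r * (n : ℝ) ^ r
  have hn0 : (0 : ℝ) < n := by exact_mod_cast hn
  have hA1 : 0 < A - 1 := by linarith
  have hc : 0 ≤ n / (A - 1) := by positivity
  have key : ∀ N : ℕ, ∑ j ∈ Finset.range (N + 1), coeffRatio α r n j ≤
      1 + n / (A - 1) * (1 - ((n : ℝ) / ((n + N : ℕ) : ℝ)) ^ (A - 1)) := by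
    intro N
    induction N with
    | zero => simp [coeffRatio_zero, div_self hn0.ne']
    | succ k ih =>
      rw [Finset.sum_range_succ]
      have h1 := coeffRatio_le_rpow (r := r) hα hn (k + 1)
      have h2 := rpow_ratio_le_telescope hA hn k
      have h3 := h1.trans h2
      linarith
  calc _ ≤ ∑ j ∈ Finset.range (N + 1), coeffRatio α r n j := by
        rw [Finset.sum_range_succ]; linarith [coeffRatio_pos α r n N]
    _ ≤ _ := key N
    _ ≤ _ := by
        have : 0 ≤ ((n : ℝ) / ((n + N : ℕ) : ℝ)) ^ (A - 1) := by positivity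
        nlinarith

lemma summable_coeffRatio {α r : ℝ} (hα : 0 < α) {n : ℕ} (hn : 1 ≤ n)
    (hA : 2 ≤ α * r * (n : ℝ) ^ r) : Summable (coeffRatio α r n) :=
  summable_of_sum_range_le (fun j => (coeffRatio_pos α r n j).le) (sum_coeffRatio_le hα hn hA)

lemma tsum_coeffRatio_le {α r : ℝ} (hα : 0 < α) {n : ℕ} (hn : 1 ≤ n)
    (hA : 2 ≤ α * r * (n : ℝ) ^ r) :
    ∑' j, coeffRatio α r n j ≤ 1 + n / (α * r * (n : ℝ) ^ r - 1) :=
  Real.tsum_le_of_sum_range_le (fun j => (coeffRatio_pos α r n j).le) (sum_coeffRatio_le hα hn hA)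

/-- Concavity of x^r: for m = n + j, (m + 1)^r - m^r ≤ r m^{r-1} ≤ r n^{r-1}. This supplies the
nonnegativity of the defects in the geometric comparison. -/
lemma exp_neg_mul_coeffRatio_le {α r : ℝ} (hα : 0 < α) (hr₀ : 0 < r) (hr₁ : r < 1) {n : ℕ}
    (hn : 1 ≤ n) (j : ℕ) :
    Real.exp (-(α * r * (n : ℝ) ^ r / n)) * coeffRatio α r n j ≤ coeffRatio α r n (j + 1) := by
  have hn0 : (0 : ℝ) < n := by exact_mod_cast hn
  set m : ℝ := ((n + j : ℕ) : ℝ) with hm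
  have hnm : (n : ℝ) ≤ m := by rw [hm]; push_cast; linarith [(Nat.cast_nonneg j : (0 : ℝ) ≤ j)]
  have hm0 : (0 : ℝ) < m := by linarith
  have hm1 : ((n + (j + 1) : ℕ) : ℝ) = m + 1 := by rw [hm]; push_cast; ring
  rw [coeffRatio, coeffRatio, hm1, ← Real.exp_add, ← hm]
  apply Real.exp_le_exp.2
  have h1 : (1 + 1 / m) ^ r ≤ 1 + r * (1 / m) :=
    rpow_one_add_le_one_add_mul_self (by linarith [one_div_pos.2 hm0]) hr₀.le hr₁.le
  have h2 : (m + 1) ^ r = m ^ r * (1 + 1 / m) ^ r := by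
    rw [← Real.mul_rpow hm0.le (by positivity)]; congr 1; field_simp
  have h3 : m ^ r / m ≤ (n : ℝ) ^ r / n := by
    rw [← Real.rpow_sub_one hm0.ne', ← Real.rpow_sub_one hn0.ne']
    exact Real.rpow_le_rpow_of_nonpos hn0 hnm (by linarith)
  have h4 : (m + 1) ^ r - m ^ r ≤ r * ((n : ℝ) ^ r / n) := by
    have h5 : m ^ r * (1 + 1 / m) ^ r ≤ m ^ r * (1 + r * (1 / m)) := by gcongr
    have h6 : m ^ r * (1 + r * (1 / m)) = m ^ r + r * (m ^ r / m) := by ring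
    have h7 := mul_le_mul_of_nonneg_left h3 hr₀.le
    linarith
  have h8 := mul_le_mul_of_nonneg_left h4 hα.le
  have h9 : α * r * (n : ℝ) ^ r / n = α * (r * ((n : ℝ) ^ r / n)) := by ring
  rw [h9]; linarith

lemma norm_exp_real_mul_I (x : ℝ) : ‖Complex.exp (x * Complex.I)‖ = 1 :=
  Complex.norm_exp_ofReal_mul_I x

lemma summable_remainderSeries {α r : ℝ} (hα : 0 < α) {n : ℕ} (hn : 1 ≤ n)
    (hA : 2 ≤ α * r * (n : ℝ) ^ r) (t : ℝ) :
    Summable fun j : ℕ =>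
      (coeffRatio α r n j : ℂ) * Complex.exp (((j : ℝ) * t : ℝ) * Complex.I) := by
  refine Summable.of_norm_bounded (summable_coeffRatio hα hn hA) fun j => ?_
  rw [norm_mul, norm_exp_real_mul_I, mul_one, Complex.norm_real, Real.norm_eq_abs,
    abs_of_pos (coeffRatio_pos _ _ _ _)]

lemma continuous_remainderSeries {α r : ℝ} (hα : 0 < α) {n : ℕ} (hn : 1 ≤ n)
    (hA : 2 ≤ α * r * (n : ℝ) ^ r) : Continuous (remainderSeries α r n) := by
  refine continuous_tsum (fun j => by fun_prop) (summable_coeffRatio hα hn hA) fun j t => ?_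
  rw [norm_mul, norm_exp_real_mul_I, mul_one, Complex.norm_real, Real.norm_eq_abs,
    abs_of_pos (coeffRatio_pos _ _ _ _)]

lemma periodic_remainderSeries (α r : ℝ) (n : ℕ) :
    Function.Periodic (remainderSeries α r n) (2 * Real.pi) := by
  intro t
  unfold remainderSeries
  congr 1; ext j; congr 1
  rw [Complex.exp_eq_exp_iff_exists_int]
  exact ⟨j, by push_cast; ring⟩

/-- After multiplication by 1 - e^{-a+it} the coefficient of e^{i(j+1)t} is the defect w j ≥ 0. The
modulus is then at most the value at t = 0, namely (1 - e^{-a}) times the sum of the coefficients,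
minus 1. The bounds 1 - e^{-a} ≤ a and 1 + n / (A - 1) for that sum leave a + 1 / (A - 1). -/
lemma norm_one_sub_exp_mul_remainderSeries_sub_one_le {α r : ℝ} (hα : 0 < α) (hr₀ : 0 < r)
    (hr₁ : r < 1) {n : ℕ} (hn : 1 ≤ n) (hA : 2 ≤ α * r * (n : ℝ) ^ r) (t : ℝ) :
    ‖(1 - Complex.exp ((-(α * r * (n : ℝ) ^ r / n) : ℝ) + t * Complex.I)) *
      remainderSeries α r n t - 1‖ ≤
      α * r * (n : ℝ) ^ r / n + 2 / (α * r * (n : ℝ) ^ r) := by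
  have hn0 : (0 : ℝ) < n := by exact_mod_cast hn
  set A := α * r * (n : ℝ) ^ r with hAdef
  set a := A / n with ha
  have ha0 : 0 < a := by rw [ha]; positivity
  set w : ℕ → ℝ := fun j => coeffRatio α r n (j + 1) - Real.exp (-a) * coeffRatio α r n j with hw
  have hw0 : ∀ j, 0 ≤ w j := fun j => sub_nonneg.2 (exp_neg_mul_coeffRatio_le hα hr₀ hr₁ hn j)
  have hS := summable_coeffRatio hα hn hA
  have hS1 : Summable fun j => coeffRatio α r n (j + 1) := (summable_nat_add_iff 1).2 hS
  have hws : Summable w := hS1.sub (hS.mul_left _)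
  have hwt : ∑' j, w j = (1 - Real.exp (-a)) * ∑' j, coeffRatio α r n j - 1 := by
    rw [hw, hS1.tsum_sub (hS.mul_left _), tsum_mul_left, hS.tsum_eq_zero_add, coeffRatio_zero]
    ring
  have hF := summable_remainderSeries hα hn hA t
  have hF1 := (summable_nat_add_iff 1).2 hF
  have hrep : (1 - Complex.exp ((-a : ℝ) + t * Complex.I)) * remainderSeries α r n t - 1 =
      ∑' j, (w j : ℂ) * Complex.exp ((((j + 1 : ℕ) : ℝ) * t : ℝ) * Complex.I) := by
    have h1 : Complex.exp ((-a : ℝ) + t * Complex.I) * remainderSeries α r n t =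
        ∑' j : ℕ, (Real.exp (-a) * coeffRatio α r n j : ℝ) *
          Complex.exp ((((j + 1 : ℕ) : ℝ) * t : ℝ) * Complex.I) := by
      rw [remainderSeries, ← tsum_mul_left]
      congr 1; ext j
      rw [mul_left_comm, ← Complex.exp_add]
      have : (-a : ℝ) + t * Complex.I + (((j : ℝ) * t : ℝ) : ℂ) * Complex.I =
        (-a : ℝ) + ((((j + 1 : ℕ) : ℝ) * t : ℝ) : ℂ) * Complex.I := by push_cast; ring
      rw [this, Complex.exp_add]
      push_cast; ring
    have h2 : Summable fun j : ℕ => ((Real.exp (-a) * coeffRatio α r n j : ℝ) : ℂ) *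
          Complex.exp ((((j + 1 : ℕ) : ℝ) * t : ℝ) * Complex.I) := by
      refine Summable.of_norm_bounded (hS.mul_left (Real.exp (-a))) fun j => ?_
      rw [norm_mul, norm_exp_real_mul_I, mul_one, Complex.norm_real, Real.norm_eq_abs,
        abs_of_pos (mul_pos (Real.exp_pos _) (coeffRatio_pos _ _ _ _))]
    rw [sub_mul, one_mul, h1, remainderSeries, hF.tsum_eq_zero_add]
    have h3 : ∀ x y z : ℂ, x + y - z - x = y - z := fun x y z => by ring
    simp only [coeffRatio_zero, Nat.cast_zero, zero_mul, Complex.ofReal_zero, Complex.exp_zero,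
      Complex.ofReal_one, mul_one, h3]
    rw [← hF1.tsum_sub h2]
    congr 1; ext j
    rw [hw]; push_cast; ring
  rw [hrep]
  have hb : ‖∑' j, (w j : ℂ) * Complex.exp ((((j + 1 : ℕ) : ℝ) * t : ℝ) * Complex.I)‖ ≤
      ∑' j, w j := by
    refine tsum_of_norm_bounded hws.hasSum fun j => ?_
    rw [norm_mul, norm_exp_real_mul_I, mul_one, Complex.norm_real, Real.norm_eq_abs,
      abs_of_nonneg (hw0 j)]
  refine hb.trans ?_
  rw [hwt]
  have h1 : 1 - Real.exp (-a) ≤ a := by linarith [Real.add_one_le_exp (-a)]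
  have h2 : 0 ≤ 1 - Real.exp (-a) := by
    have := Real.exp_le_one_iff.2 (neg_nonpos.2 ha0.le); linarith
  have h3 := tsum_coeffRatio_le hα hn hA
  rw [← hAdef] at h3
  have h4 : (1 - Real.exp (-a)) * ∑' j, coeffRatio α r n j ≤ a * (1 + n / (A - 1)) :=
    mul_le_mul h1 h3 (tsum_nonneg fun j => (coeffRatio_pos _ _ _ _).le) ha0.le
  have hA1 : 0 < A - 1 := by linarith
  have h5 : a * (1 + n / (A - 1)) = a + 1 + 1 / (A - 1) := by
    rw [ha]; field_simp; ring
  have h6 : 1 / (A - 1) ≤ 2 / A := by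
    rw [div_le_div_iff₀ hA1 (by linarith)]; linarith
  linarith

/-! ### Pointwise estimates for the geometric and Cauchy kernels -/

lemma norm_exp_sub_one_sub_id_le_of_re_nonpos {z : ℂ} (hz : z.re ≤ 0) :
    ‖Complex.exp z - 1 - z‖ ≤ 3 * ‖z‖ ^ 2 := by
  rcases le_total ‖z‖ 1 with h | h
  · exact (Complex.norm_exp_sub_one_sub_id_le h).trans (by nlinarith [sq_nonneg ‖z‖])
  · have h1 : ‖Complex.exp z‖ ≤ 1 := by
      rw [Complex.norm_exp]; exact Real.exp_le_one_iff.2 hz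
    calc ‖Complex.exp z - 1 - z‖ ≤ ‖Complex.exp z - 1‖ + ‖z‖ := norm_sub_le _ _
      _ ≤ ‖Complex.exp z‖ + ‖(1 : ℂ)‖ + ‖z‖ := by gcongr; exact norm_sub_le _ _
      _ ≤ 3 * ‖z‖ ^ 2 := by rw [norm_one]; nlinarith

/-- The square of the right side is (1 - e^{-a})² + 2 e^{-a} (1 - cos t). Here 1 - e^{-a} ≥ a / 2,
and on the period 1 - cos t ≥ 2t²/π² ≥ t²/5, while e^{-a} ≥ 13/14. -/
lemma half_norm_le_norm_one_sub_exp {a t : ℝ} (ha₀ : 0 < a) (ha₁ : a ≤ 1 / 14)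
    (ht : |t| ≤ Real.pi) :
    ‖((-a : ℝ) + t * Complex.I : ℂ)‖ / 2 ≤ ‖1 - Complex.exp ((-a : ℝ) + t * Complex.I)‖ := by
  have h1 : ‖((-a : ℝ) + t * Complex.I : ℂ)‖ ^ 2 = a ^ 2 + t ^ 2 := by
    rw [Complex.sq_norm, Complex.normSq_add_mul_I]; ring
  have h2 : ‖1 - Complex.exp ((-a : ℝ) + t * Complex.I)‖ ^ 2 =
      (1 - Real.exp (-a)) ^ 2 + 2 * Real.exp (-a) * (1 - Real.cos t) := by
    rw [Complex.sq_norm, Complex.exp_add, Complex.exp_mul_I, ← Complex.ofReal_exp,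
      ← Complex.ofReal_cos, ← Complex.ofReal_sin]
    simp only [Complex.normSq_apply, Complex.sub_re, Complex.sub_im, Complex.mul_re,
      Complex.mul_im, Complex.add_re, Complex.add_im, Complex.ofReal_re, Complex.ofReal_im,
      Complex.one_re, Complex.one_im, Complex.I_re, Complex.I_im]
    linear_combination Real.exp (-a) ^ 2 * Real.sin_sq_add_cos_sq t
  have h3 : Real.exp (-a) ≤ 1 - a / 2 := by
    have h5 : 1 + a ≤ Real.exp a := by linarith [Real.add_one_le_exp a]
    rw [Real.exp_neg]
    calc (Real.exp a)⁻¹ ≤ (1 + a)⁻¹ := by gcongr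
      _ ≤ 1 - a / 2 := by
        rw [inv_le_iff_one_le_mul₀ (by linarith)]; nlinarith
  have h4 : 13 / 14 ≤ Real.exp (-a) := by linarith [Real.add_one_le_exp (-a)]
  have h6 : 2 / Real.pi ^ 2 * t ^ 2 ≤ 1 - Real.cos t := by
    linarith [Real.cos_le_one_sub_mul_cos_sq ht]
  have h7 : (1 : ℝ) / 5 ≤ 2 / Real.pi ^ 2 := by
    rw [div_le_div_iff₀ (by norm_num) (by positivity)]
    nlinarith [Real.pi_lt_d2, Real.pi_pos]
  have h8 : t ^ 2 / 5 ≤ 1 - Real.cos t := by nlinarith [sq_nonneg t]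
  apply le_of_sq_le_sq _ (norm_nonneg _)
  rw [div_pow, h1, h2]
  nlinarith [sq_nonneg t]

lemma norm_geomKernel_le {a t : ℝ} (ha₀ : 0 < a) (ha₁ : a ≤ 1 / 14) (ht : |t| ≤ Real.pi) :
    ‖geomKernel a t‖ ≤ 2 * ‖cauchyKernel a t‖ := by
  have h := half_norm_le_norm_one_sub_exp ha₀ ha₁ ht
  have e : (a : ℂ) - t * Complex.I = -((-a : ℝ) + t * Complex.I) := by push_cast; ring
  have hz : 0 < ‖((-a : ℝ) + t * Complex.I : ℂ)‖ := by
    rw [norm_pos_iff]; intro h0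
    have := congrArg Complex.re h0
    simp at this; linarith
  rw [geomKernel, cauchyKernel, norm_inv, norm_inv, e, norm_neg]
  calc _ ≤ (‖((-a : ℝ) + t * Complex.I : ℂ)‖ / 2)⁻¹ := by gcongr
    _ = _ := by rw [inv_div, div_eq_mul_inv]

/-- The poles at z = 0 cancel: with z = -a + it the difference is -(e^z - 1 - z) / (z (1 - e^z)),
with numerator at most 3|z|² and denominator at least |z|²/2. -/
lemma norm_geomKernel_sub_cauchyKernel_le {a t : ℝ} (ha₀ : 0 < a) (ha₁ : a ≤ 1 / 14)
    (ht : |t| ≤ Real.pi) : ‖geomKernel a t - cauchyKernel a t‖ ≤ 6 := by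
  have h := half_norm_le_norm_one_sub_exp ha₀ ha₁ ht
  have e : (a : ℂ) - t * Complex.I = -((-a : ℝ) + t * Complex.I) := by push_cast; ring
  set z : ℂ := (-a : ℝ) + t * Complex.I with hzdef
  have hzre : z.re = -a := by simp [hzdef]
  have hz : 0 < ‖z‖ := by
    rw [norm_pos_iff]; intro h0
    have := congrArg Complex.re h0
    simp [hzre] at this; linarith
  have hz0 : z ≠ 0 := norm_pos_iff.1 hz
  have hw : 1 - Complex.exp z ≠ 0 := norm_pos_iff.1 (by linarith)
  rw [geomKernel, cauchyKernel, e, ← hzdef]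
  have e2 : (1 - Complex.exp z)⁻¹ - (-z)⁻¹ = -(Complex.exp z - 1 - z) / (z * (1 - Complex.exp z)) := by
    field_simp; ring
  rw [e2, norm_div, norm_neg, norm_mul, div_le_iff₀ (by apply mul_pos hz; linarith)]
  have := norm_exp_sub_one_sub_id_le_of_re_nonpos (z := z) (by rw [hzre]; linarith)
  nlinarith

lemma norm_geomKernel_le_inv {a : ℝ} (ha₀ : 0 < a) (ha₁ : a ≤ 1 / 14) (t : ℝ) :
    ‖geomKernel a t‖ ≤ 2 / a := by
  have h1 : 1 + a ≤ Real.exp a := by linarith [Real.add_one_le_exp a]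
  have h3 : Real.exp (-a) ≤ 1 - a / 2 := by
    rw [Real.exp_neg]
    calc (Real.exp a)⁻¹ ≤ (1 + a)⁻¹ := by gcongr
      _ ≤ 1 - a / 2 := by
        rw [inv_le_iff_one_le_mul₀ (by linarith)]; nlinarith
  have h4 : a / 2 ≤ ‖1 - Complex.exp ((-a : ℝ) + t * Complex.I)‖ := by
    have h5 := norm_sub_norm_le (1 : ℂ) (Complex.exp ((-a : ℝ) + t * Complex.I))
    rw [Complex.norm_exp] at h5
    simp at h5
    simp only [Complex.ofReal_neg]
    linarith
  rw [geomKernel, norm_inv]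
  calc _ ≤ (a / 2)⁻¹ := by gcongr
    _ = _ := by rw [inv_div]

lemma one_sub_exp_ne_zero {a : ℝ} (ha₀ : 0 < a) (t : ℝ) :
    1 - Complex.exp ((-a : ℝ) + t * Complex.I) ≠ 0 := by
  intro h
  have h1 : ‖Complex.exp ((-a : ℝ) + t * Complex.I)‖ = 1 := by
    rw [← sub_eq_zero.1 h, norm_one]
  rw [Complex.norm_exp] at h1
  simp at h1
  linarith

lemma continuous_geomKernel {a : ℝ} (ha₀ : 0 < a) : Continuous (geomKernel a) := by
  unfold geomKernel
  exact Continuous.inv₀ (by fun_prop) (one_sub_exp_ne_zero ha₀)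

lemma continuous_cauchyKernel {a : ℝ} (ha₀ : 0 < a) : Continuous (cauchyKernel a) := by
  unfold cauchyKernel
  refine Continuous.inv₀ (by fun_prop) fun t h => ?_
  have := congrArg Complex.re h
  simp at this
  linarith

lemma periodic_geomKernel (a : ℝ) : Function.Periodic (geomKernel a) (2 * Real.pi) := by
  intro t
  unfold geomKernel
  congr 2
  rw [Complex.exp_eq_exp_iff_exists_int]
  exact ⟨1, by push_cast; ring⟩

lemma norm_cauchyKernel (a t : ℝ) : ‖cauchyKernel a t‖ = 1 / Real.sqrt (a ^ 2 + t ^ 2) := by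
  rw [cauchyKernel, norm_inv, one_div]
  congr 1
  have : (a : ℂ) - t * Complex.I = (a : ℝ) + ((-t : ℝ) : ℂ) * Complex.I := by push_cast; ring
  rw [this, Complex.norm_add_mul_I]
  congr 1; ring

/-- The resolvent identity for a difference of inverses. One kernel factor is spent on the uniform
bound 2 / a; the other is kept, so that its L_q norm can be used later. -/
lemma norm_geomKernel_add_sub_le {a : ℝ} (ha₀ : 0 < a) (ha₁ : a ≤ 1 / 14) (t s : ℝ) :
    ‖geomKernel a (t + s) - geomKernel a t‖ ≤ 2 / a * |s| * ‖geomKernel a t‖ := by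
  have h1 := one_sub_exp_ne_zero ha₀ t
  have h2 := one_sub_exp_ne_zero ha₀ (t + s)
  have e : geomKernel a (t + s) - geomKernel a t = geomKernel a (t + s) *
      (Complex.exp ((-a : ℝ) + ((t + s : ℝ) : ℂ) * Complex.I) -
        Complex.exp ((-a : ℝ) + t * Complex.I)) * geomKernel a t := by
    unfold geomKernel
    rw [inv_sub_inv h2 h1]
    field_simp
    ring
  have e2 : Complex.exp ((-a : ℝ) + ((t + s : ℝ) : ℂ) * Complex.I) -
        Complex.exp ((-a : ℝ) + t * Complex.I) =
      Complex.exp ((-a : ℝ) + t * Complex.I) * (Complex.exp (Complex.I * s) - 1) := by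
    rw [mul_sub, ← Complex.exp_add, mul_one]
    congr 2; push_cast; ring
  have h3 : ‖Complex.exp ((-a : ℝ) + t * Complex.I)‖ ≤ 1 := by
    rw [Complex.norm_exp]; simp; linarith
  have h4 := Real.norm_exp_I_mul_ofReal_sub_one_le (x := s)
  rw [e, norm_mul, norm_mul, e2, norm_mul]
  have h5 := norm_geomKernel_le_inv ha₀ ha₁ (t + s)
  rw [Real.norm_eq_abs] at h4
  have h6 : ‖Complex.exp ((-a : ℝ) + t * Complex.I)‖ * ‖Complex.exp (Complex.I * s) - 1‖ ≤
      |s| := by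
    calc _ ≤ 1 * |s| := by gcongr
      _ = _ := one_mul _
  gcongr

/-- The difference is the geometric kernel times a quantity of size at most a + 2 / A, and a times
the kernel is at most 2. -/
lemma norm_remainderSeries_sub_geomKernel_le {α r : ℝ} (hα : 0 < α) (hr₀ : 0 < r)
    (hr₁ : r < 1) {n : ℕ} (hn : 1 ≤ n) (hA : 2 ≤ α * r * (n : ℝ) ^ r)
    (ha₁ : α * r * (n : ℝ) ^ r / n ≤ 1 / 14) (t : ℝ) :
    ‖remainderSeries α r n t - geomKernel (α * r * (n : ℝ) ^ r / n) t‖ ≤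
      2 + 2 / (α * r * (n : ℝ) ^ r) * ‖geomKernel (α * r * (n : ℝ) ^ r / n) t‖ := by
  have hn0 : (0 : ℝ) < n := by exact_mod_cast hn
  have h := norm_one_sub_exp_mul_remainderSeries_sub_one_le hα hr₀ hr₁ hn hA t
  set a := α * r * (n : ℝ) ^ r / n with ha
  have ha0 : 0 < a := by rw [ha]; positivity
  have e : remainderSeries α r n t - geomKernel a t = geomKernel a t *
      ((1 - Complex.exp ((-a : ℝ) + t * Complex.I)) * remainderSeries α r n t - 1) := by
    have := one_sub_exp_ne_zero ha0 t
    unfold geomKernel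
    field_simp
  rw [e, norm_mul]
  have h1 := norm_geomKernel_le_inv ha0 ha₁ t
  have h2 : ‖geomKernel a t‖ * a ≤ 2 := by rwa [le_div_iff₀ ha0] at h1
  calc _ ≤ ‖geomKernel a t‖ * (a + 2 / (α * r * (n : ℝ) ^ r)) := by gcongr
    _ = ‖geomKernel a t‖ * a + 2 / (α * r * (n : ℝ) ^ r) * ‖geomKernel a t‖ := by ring
    _ ≤ _ := by gcongr

/-! ### L_q norms over one period -/

/-- Lebesgue measure on the period `(-π, π]`. -/
noncomputable abbrev periodMeasure : Measure ℝ := volume.restrict (Set.Ioc (-Real.pi) Real.pi)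

/-- The real-valued `L_q` norm over the period. -/
noncomputable def normOn {E : Type*} [NormedAddCommGroup E] (q : ℝ≥0∞) (f : ℝ → E) : ℝ :=
  (eLpNorm f q periodMeasure).toReal

variable {E E₁ E₂ E₃ : Type*} [NormedAddCommGroup E] [NormedAddCommGroup E₁]
  [NormedAddCommGroup E₂] [NormedAddCommGroup E₃]

lemma periodMeasure_univ : periodMeasure Set.univ = ENNReal.ofReal (2 * Real.pi) := by
  simp [periodMeasure, two_mul]

lemma memLp_of_continuous {f : ℝ → E} (hf : Continuous f) (q : ℝ≥0∞) :
    MemLp f q periodMeasure := by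
  obtain ⟨C, hC⟩ := (isCompact_Icc (a := -Real.pi) (b := Real.pi)).exists_bound_of_continuousOn
    hf.continuousOn
  refine MemLp.of_bound hf.aestronglyMeasurable C ?_
  filter_upwards [ae_restrict_mem measurableSet_Ioc] with x hx
  exact hC x (Set.Ioc_subset_Icc_self hx)

lemma normOn_nonneg (q : ℝ≥0∞) (f : ℝ → E) : 0 ≤ normOn q f := ENNReal.toReal_nonneg

lemma normOn_le_add {q : ℝ≥0∞} (hq : 1 ≤ q) {f : ℝ → E₁} {g : ℝ → E₂} {h : ℝ → E₃}
    (hg : MemLp g q periodMeasure) (hh : MemLp h q periodMeasure)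
    (H : ∀ t ∈ Set.Ioc (-Real.pi) Real.pi, ‖f t‖ ≤ ‖g t‖ + ‖h t‖) :
    normOn q f ≤ normOn q g + normOn q h := by
  unfold normOn
  rw [← ENNReal.toReal_add hg.eLpNorm_ne_top hh.eLpNorm_ne_top]
  refine ENNReal.toReal_mono (by simp [hg.eLpNorm_ne_top, hh.eLpNorm_ne_top]) ?_
  calc eLpNorm f q periodMeasure ≤ eLpNorm (fun t => ‖g t‖ + ‖h t‖) q periodMeasure := by
        refine eLpNorm_mono_ae_real ?_
        filter_upwards [ae_restrict_mem measurableSet_Ioc] with t ht using H t ht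
    _ ≤ eLpNorm (fun t => ‖g t‖) q periodMeasure + eLpNorm (fun t => ‖h t‖) q periodMeasure :=
        eLpNorm_add_le hg.1.norm hh.1.norm hq
    _ = _ := by rw [eLpNorm_norm, eLpNorm_norm]

lemma normOn_mono {q : ℝ≥0∞} {f : ℝ → E₁} {g : ℝ → E₂} (hg : MemLp g q periodMeasure)
    (H : ∀ t ∈ Set.Ioc (-Real.pi) Real.pi, ‖f t‖ ≤ ‖g t‖) : normOn q f ≤ normOn q g := by
  refine ENNReal.toReal_mono hg.eLpNorm_ne_top (eLpNorm_mono_ae ?_)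
  filter_upwards [ae_restrict_mem measurableSet_Ioc] with t ht using H t ht

lemma normOn_const_mul (q : ℝ≥0∞) (c : ℝ) (f : ℝ → ℝ) :
    normOn q (fun t => c * f t) = |c| * normOn q f := by
  have : (fun t => c * f t) = c • f := rfl
  rw [normOn, this, eLpNorm_const_smul, ENNReal.toReal_mul, toReal_enorm, Real.norm_eq_abs, normOn]

lemma normOn_norm (q : ℝ≥0∞) (f : ℝ → E) : normOn q (fun t => ‖f t‖) = normOn q f := by
  rw [normOn, eLpNorm_norm, normOn]

lemma one_lt_two_pi : 1 < 2 * Real.pi := by linarith [Real.pi_gt_three]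

lemma normOn_const {q : ℝ≥0∞} (hq : 1 ≤ q) {c : ℝ} (hc : 0 ≤ c) :
    normOn q (fun _ => c) = c * (2 * Real.pi) ^ (1 / q).toReal := by
  have h0 : q ≠ 0 := (zero_lt_one.trans_le hq).ne'
  rw [normOn, eLpNorm_const _ h0 (by
    intro h; have := congrArg (fun m : Measure ℝ => m Set.univ) h
    simp only [periodMeasure_univ] at this
    simp at this; linarith [Real.pi_pos]),
    periodMeasure_univ, ENNReal.toReal_mul, toReal_enorm, Real.norm_eq_abs, abs_of_nonneg hc,
    ← ENNReal.toReal_rpow, ENNReal.toReal_ofReal (by positivity), ENNReal.toReal_div]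
  simp

lemma toReal_one_div_le_one {q : ℝ≥0∞} (hq : 1 ≤ q) : (1 / q).toReal ≤ 1 := by
  rw [← ENNReal.toReal_one]
  exact ENNReal.toReal_mono ENNReal.one_ne_top (by simpa using hq)

lemma normOn_const_le {q : ℝ≥0∞} (hq : 1 ≤ q) {c : ℝ} (hc : 0 ≤ c) :
    normOn q (fun _ => c) ≤ c * (2 * Real.pi) := by
  rw [normOn_const hq hc]
  gcongr
  calc (2 * Real.pi) ^ (1 / q).toReal ≤ (2 * Real.pi) ^ (1 : ℝ) :=
        Real.rpow_le_rpow_of_exponent_le one_lt_two_pi.le (toReal_one_div_le_one hq)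
    _ = _ := Real.rpow_one _

instance fact_zero_lt_two_pi : Fact (0 < 2 * Real.pi) := ⟨Real.two_pi_pos⟩

lemma measurePreserving_mk_period :
    MeasurePreserving ((↑) : ℝ → AddCircle (2 * Real.pi)) periodMeasure volume := by
  have h := AddCircle.measurePreserving_mk (2 * Real.pi) (-Real.pi)
  have e : -Real.pi + 2 * Real.pi = Real.pi := by ring
  rwa [e] at h

lemma stronglyMeasurable_lift {f : ℝ → E} (hf : StronglyMeasurable f)
    (hp : Function.Periodic f (2 * Real.pi)) : StronglyMeasurable hp.lift := by
  have : hp.lift = f ∘ Subtype.val ∘ AddCircle.measurableEquivIoc (2 * Real.pi) 0 := by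
    ext x
    obtain ⟨y, rfl⟩ := (AddCircle.measurableEquivIoc (2 * Real.pi) 0).symm.surjective x
    rw [Function.comp_apply, Function.comp_apply, MeasurableEquiv.apply_symm_apply]
    exact hp.lift_coe y
  rw [this]
  exact hf.comp_measurable
    (measurable_subtype_coe.comp (AddCircle.measurableEquivIoc (2 * Real.pi) 0).measurable)

/-- Translation does not preserve the restricted measure on the line, but it does preserve Haar
measure on the circle, to which periodic functions descend. -/
lemma eLpNorm_comp_add_of_periodic {f : ℝ → E} (hf : StronglyMeasurable f)
    (hp : Function.Periodic f (2 * Real.pi)) (q : ℝ≥0∞) (s : ℝ) :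
    eLpNorm (fun t => f (t + s)) q periodMeasure = eLpNorm f q periodMeasure := by
  have hg := stronglyMeasurable_lift hf hp
  have e1 : f = hp.lift ∘ ((↑) : ℝ → AddCircle (2 * Real.pi)) := by
    ext t; exact (hp.lift_coe t).symm
  have e2 : (fun t => f (t + s)) =
      (hp.lift ∘ fun x => x + (s : AddCircle (2 * Real.pi))) ∘ ((↑) : ℝ → AddCircle (2 * Real.pi)) := by
    ext t
    simp only [Function.comp_apply]
    rw [← AddCircle.coe_add, hp.lift_coe]
  have hm := measurePreserving_add_right (volume : Measure (AddCircle (2 * Real.pi))) s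
  rw [e2, eLpNorm_comp_measurePreserving (hg.comp_measurable hm.measurable).aestronglyMeasurable
    measurePreserving_mk_period, eLpNorm_comp_measurePreserving hg.aestronglyMeasurable hm]
  conv_rhs => rw [e1]
  rw [eLpNorm_comp_measurePreserving hg.aestronglyMeasurable measurePreserving_mk_period]

lemma eLpNorm_comp_sub_left_of_periodic {f : ℝ → E} (hf : StronglyMeasurable f)
    (hp : Function.Periodic f (2 * Real.pi)) (q : ℝ≥0∞) (s : ℝ) :
    eLpNorm (fun t => f (s - t)) q periodMeasure = eLpNorm f q periodMeasure := by
  have hg := stronglyMeasurable_lift hf hp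
  have e1 : f = hp.lift ∘ ((↑) : ℝ → AddCircle (2 * Real.pi)) := by
    ext t; exact (hp.lift_coe t).symm
  have e2 : (fun t => f (s - t)) =
      (hp.lift ∘ fun x => (s : AddCircle (2 * Real.pi)) - x) ∘ ((↑) : ℝ → AddCircle (2 * Real.pi)) := by
    ext t
    simp only [Function.comp_apply]
    rw [← AddCircle.coe_sub, hp.lift_coe]
  have hm := Measure.measurePreserving_sub_left (volume : Measure (AddCircle (2 * Real.pi))) s
  rw [e2, eLpNorm_comp_measurePreserving (hg.comp_measurable hm.measurable).aestronglyMeasurable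
    measurePreserving_mk_period, eLpNorm_comp_measurePreserving hg.aestronglyMeasurable hm]
  conv_rhs => rw [e1]
  rw [eLpNorm_comp_measurePreserving hg.aestronglyMeasurable measurePreserving_mk_period]

lemma normOn_comp_add {f : ℝ → E} (hf : StronglyMeasurable f)
    (hp : Function.Periodic f (2 * Real.pi)) (q : ℝ≥0∞) (s : ℝ) :
    normOn q (fun t => f (t + s)) = normOn q f := by
  rw [normOn, eLpNorm_comp_add_of_periodic hf hp, normOn]

lemma norm_le_normOn_top {f : ℝ → E} (hf : Continuous f)
    (hp : Function.Periodic f (2 * Real.pi)) (t : ℝ) : ‖f t‖ ≤ normOn ∞ f := by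
  -- The inequality to be proved says that this maximum equals the constant `normOn ∞ f`. It does so
  -- almost everywhere, and continuous functions on the circle that agree almost everywhere are
  -- equal.
  have hn : Function.Periodic (fun t => max ‖f t‖ (normOn ∞ f)) (2 * Real.pi) := fun t => by
    simp only [hp t]
  have hlc : Continuous hn.lift := by
    apply continuous_coinduced_dom.2
    show Continuous fun t => max ‖f t‖ (normOn ∞ f)
    fun_prop
  have hae : ∀ᵐ t ∂periodMeasure, ‖f t‖ ≤ normOn ∞ f := by
    have h := ae_le_eLpNormEssSup (f := f) (μ := periodMeasure)
    filter_upwards [h] with t ht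
    have hfin := (memLp_of_continuous hf ∞).eLpNorm_ne_top
    rw [← toReal_enorm]
    refine ENNReal.toReal_mono hfin ?_
    rwa [eLpNorm_exponent_top]
  have hae2 : ∀ᵐ x : AddCircle (2 * Real.pi), hn.lift x = normOn ∞ f := by
    rw [← measurePreserving_mk_period.map_eq]
    rw [ae_map_iff measurePreserving_mk_period.measurable.aemeasurable
      (measurableSet_eq_fun hlc.measurable measurable_const)]
    filter_upwards [hae] with t ht
    rw [hn.lift_coe]; exact max_eq_right ht
  have heq := (Continuous.ae_eq_iff_eq (volume : Measure (AddCircle (2 * Real.pi))) hlc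
    (continuous_const (y := normOn ∞ f))).1 hae2
  have h1 := congrFun heq (t : AddCircle (2 * Real.pi))
  rw [hn.lift_coe] at h1
  exact (le_max_left _ _).trans h1.le

/-! ### The rotating phase and averaging over it -/

/-- The real part of `exp (i (n t + σ)) f t`. -/
noncomputable def phasePart (n : ℕ) (f : ℝ → ℂ) (σ t : ℝ) : ℝ :=
  (Complex.exp (((n : ℝ) * t + σ : ℝ) * Complex.I) * f t).re

lemma continuous_phasePart {n : ℕ} {f : ℝ → ℂ} (hf : Continuous f) :
    Continuous fun x : ℝ × ℝ => phasePart n f x.1 x.2 := by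
  unfold phasePart
  fun_prop

lemma continuous_phasePart_right {n : ℕ} {f : ℝ → ℂ} (hf : Continuous f) (σ : ℝ) :
    Continuous (phasePart n f σ) := by
  unfold phasePart
  fun_prop

lemma periodic_phasePart {n : ℕ} {f : ℝ → ℂ} (hf : Function.Periodic f (2 * Real.pi)) (σ : ℝ) :
    Function.Periodic (phasePart n f σ) (2 * Real.pi) := by
  intro t
  unfold phasePart
  rw [hf t]
  congr 2
  rw [Complex.exp_eq_exp_iff_exists_int]
  exact ⟨n, by push_cast; ring⟩

lemma abs_phasePart_le (n : ℕ) (f : ℝ → ℂ) (σ t : ℝ) : |phasePart n f σ t| ≤ ‖f t‖ := by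
  refine (Complex.abs_re_le_norm _).trans ?_
  rw [norm_mul, norm_exp_real_mul_I, one_mul]

lemma phasePart_eq_norm_mul_cos (n : ℕ) (f : ℝ → ℂ) (σ t : ℝ) :
    phasePart n f σ t = ‖f t‖ * Real.cos (σ + (n * t + (f t).arg)) := by
  have : Complex.exp (((n : ℝ) * t + σ : ℝ) * Complex.I) * f t =
      ((‖f t‖ : ℝ) : ℂ) * Complex.exp ((σ + (n * t + (f t).arg) : ℝ) * Complex.I) := by
    conv_lhs => rw [← Complex.norm_mul_exp_arg_mul_I (f t)]
    rw [mul_left_comm, ← Complex.exp_add]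
    congr 2; push_cast; ring
  rw [phasePart, this, Complex.re_ofReal_mul, Complex.exp_ofReal_mul_I_re]

/-- Moving t by τ / n advances the phase nt by exactly τ, so only the variation of f remains. -/
lemma abs_phasePart_sub_shift_le {n : ℕ} (hn : 1 ≤ n) (f : ℝ → ℂ) (σ τ t : ℝ) :
    |phasePart n f (σ + τ) t - phasePart n f σ (t + τ / n)| ≤ ‖f (t + τ / n) - f t‖ := by
  have hn0 : (n : ℝ) ≠ 0 := by positivity
  have e : (n : ℝ) * (t + τ / n) + σ = n * t + (σ + τ) := by field_simp; ring
  rw [phasePart, phasePart, e, ← Complex.sub_re, ← mul_sub]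
  refine (Complex.abs_re_le_norm _).trans ?_
  rw [norm_mul, norm_exp_real_mul_I, one_mul, norm_sub_rev]

/-- `f` varies by at most `D`, in the `L_q` norm, under translations by at most `π / n`. -/
def ShiftBound (q : ℝ≥0∞) (n : ℕ) (f : ℝ → ℂ) (D : ℝ) : Prop :=
  ∀ s : ℝ, |s| ≤ Real.pi / n → normOn q (fun t => f (t + s) - f t) ≤ D

lemma normOn_phasePart_sub_le {q : ℝ≥0∞} (hq : 1 ≤ q) {n : ℕ} (hn : 1 ≤ n) {f : ℝ → ℂ}
    (hf : Continuous f) (hp : Function.Periodic f (2 * Real.pi)) {D : ℝ}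
    (hD : ShiftBound q n f D) (σ : ℝ) {τ : ℝ} (hτ : |τ| ≤ Real.pi) :
    normOn q (phasePart n f (σ + τ)) ≤ normOn q (phasePart n f σ) + D ∧
      normOn q (phasePart n f σ) ≤ normOn q (phasePart n f (σ + τ)) + D := by
  have hn0 : (0 : ℝ) < n := by exact_mod_cast hn
  have hs : |τ / n| ≤ Real.pi / n := by
    rw [abs_div, abs_of_pos hn0]; gcongr
  have h1 := hD _ hs
  have h2 : normOn q (fun t => phasePart n f σ (t + τ / n)) = normOn q (phasePart n f σ) :=
    normOn_comp_add (continuous_phasePart_right hf σ).stronglyMeasurable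
      (periodic_phasePart hp σ) q _
  have hc : Continuous fun t => phasePart n f σ (t + τ / n) :=
    (continuous_phasePart_right hf σ).comp (by fun_prop)
  have hd : MemLp (fun t => f (t + τ / n) - f t) q periodMeasure :=
    memLp_of_continuous (by fun_prop) q
  have hb := fun t => abs_phasePart_sub_shift_le hn f σ τ t
  constructor
  · rw [← h2]
    refine (normOn_le_add hq (memLp_of_continuous hc q) hd fun t _ => ?_).trans
      (add_le_add_right h1 _)
    have := abs_sub_abs_le_abs_sub (phasePart n f (σ + τ) t) (phasePart n f σ (t + τ / n))
    simp only [Real.norm_eq_abs]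
    linarith [hb t]
  · rw [← h2]
    refine (normOn_le_add hq (memLp_of_continuous (continuous_phasePart_right hf (σ + τ)) q) hd
      fun t _ => ?_).trans (add_le_add_right h1 _)
    have := abs_sub_abs_le_abs_sub (phasePart n f σ (t + τ / n)) (phasePart n f (σ + τ) t)
    rw [abs_sub_comm (phasePart n f σ (t + τ / n))] at this
    simp only [Real.norm_eq_abs]
    linarith [hb t]

lemma eLpNorm_rpow_toReal {E : Type*} [NormedAddCommGroup E] {q : ℝ≥0∞} (hq : 1 ≤ q)
    (hq' : q ≠ ∞) (f : ℝ → E) (μ : Measure ℝ) :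
    eLpNorm f q μ ^ q.toReal = ∫⁻ t, ‖f t‖ₑ ^ q.toReal ∂μ := by
  have h0 : q ≠ 0 := (zero_lt_one.trans_le hq).ne'
  rw [eLpNorm_eq_lintegral_rpow_enorm_toReal h0 hq', ← ENNReal.rpow_mul,
    one_div_mul_cancel (ENNReal.toReal_pos h0 hq').ne', ENNReal.rpow_one]

/-- By Tonelli the phase is integrated first. For fixed t the integrand is ‖f t‖^q times a translate
of |cos|^q, whose integral over a period does not depend on t. -/
lemma lintegral_eLpNorm_phasePart {q : ℝ≥0∞} (hq : 1 ≤ q) (hq' : q ≠ ∞) {n : ℕ} {f : ℝ → ℂ}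
    (hf : Continuous f) (σ : ℝ) :
    ∫⁻ τ, eLpNorm (phasePart n f (σ + τ)) q periodMeasure ^ q.toReal ∂periodMeasure =
      (eLpNorm Real.cos q periodMeasure * eLpNorm f q periodMeasure) ^ q.toReal := by
  have hq0 : 0 ≤ q.toReal := ENNReal.toReal_nonneg
  simp_rw [eLpNorm_rpow_toReal hq hq' _ periodMeasure]
  rw [lintegral_lintegral_swap]
  · have h : ∀ t, ∫⁻ τ, ‖phasePart n f (σ + τ) t‖ₑ ^ q.toReal ∂periodMeasure =
        ‖f t‖ₑ ^ q.toReal * eLpNorm Real.cos q periodMeasure ^ q.toReal := by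
      intro t
      have hs := eLpNorm_comp_add_of_periodic Real.continuous_cos.stronglyMeasurable
        Real.cos_periodic q (σ + (n * t + (f t).arg))
      rw [← hs, eLpNorm_rpow_toReal hq hq', ← lintegral_const_mul']
      · congr 1; ext τ
        rw [phasePart_eq_norm_mul_cos, enorm_mul, enorm_norm, ENNReal.mul_rpow_of_nonneg _ _ hq0]
        congr 4; ring
      · exact ENNReal.rpow_ne_top_of_nonneg hq0 enorm_ne_top
    simp_rw [h]
    rw [lintegral_mul_const', ENNReal.mul_rpow_of_nonneg _ _ hq0, mul_comm,
      eLpNorm_rpow_toReal hq hq' f]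
    exact ENNReal.rpow_ne_top_of_nonneg hq0
      (memLp_of_continuous Real.continuous_cos q).eLpNorm_ne_top
  · refine Measurable.aemeasurable ?_
    have : Continuous fun x : ℝ × ℝ => phasePart n f (σ + x.1) x.2 := by
      have := continuous_phasePart (n := n) hf
      exact this.comp (f := fun x : ℝ × ℝ => (σ + x.1, x.2)) (by fun_prop)
    exact (this.enorm.measurable.pow_const _)

lemma normOn_cos_le {q : ℝ≥0∞} (hq : 1 ≤ q) :
    normOn q Real.cos ≤ (2 * Real.pi) ^ (1 / q).toReal := by
  have h := normOn_const (c := 1) hq zero_le_one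
  rw [one_mul] at h
  rw [← h]
  exact normOn_mono (memLp_of_continuous continuous_const q) fun t _ => by
    simpa using Real.abs_cos_le_one t

lemma normOn_top_cos : normOn ∞ Real.cos = 1 := by
  apply le_antisymm
  · simpa using normOn_cos_le (q := ∞) le_top
  · simpa using norm_le_normOn_top Real.continuous_cos Real.cos_periodic 0

lemma ofReal_normOn {q : ℝ≥0∞} {E : Type*} [NormedAddCommGroup E] {f : ℝ → E}
    (hf : Continuous f) : ENNReal.ofReal (normOn q f) = eLpNorm f q periodMeasure :=
  ENNReal.ofReal_toReal (memLp_of_continuous hf q).eLpNorm_ne_top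

/-- The `L_q` norm of `Re (exp (i (n t + σ)) f t)` is close to its value averaged over the phase. -/
lemma abs_normOn_phasePart_sub_le {q : ℝ≥0∞} (hq : 1 ≤ q) {n : ℕ} (hn : 1 ≤ n) {f : ℝ → ℂ}
    (hf : Continuous f) (hp : Function.Periodic f (2 * Real.pi)) {D : ℝ}
    (hD : ShiftBound q n f D) (σ : ℝ) :
    |normOn q (phasePart n f σ) -
      normOn q Real.cos / (2 * Real.pi) ^ (1 / q).toReal * normOn q f| ≤ D := by
  have hn0 : (0 : ℝ) < n := by exact_mod_cast hn
  set X := normOn q (phasePart n f σ) with hX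
  have hX0 : 0 ≤ X := normOn_nonneg _ _
  have hD0 : 0 ≤ D := by
    refine le_trans (normOn_nonneg q _) (hD 0 (by simp; positivity))
  rcases eq_or_ne q ∞ with rfl | hq'
  · have h1 : X ≤ normOn ∞ f := normOn_mono (memLp_of_continuous hf _) fun t _ => by
      rw [Real.norm_eq_abs]; exact abs_phasePart_le n f σ t
    have h2 : normOn ∞ f ≤ X + D := by
      have hb : ∀ t, ‖f t‖ ≤ X + D := by
        intro t
        -- The phase is tuned so that the cosine at t equals 1, then reduced modulo 2π to the range
        -- where the shift bound applies.
        obtain ⟨τ, hτ, hτ2⟩ : ∃ τ : ℝ, |τ| ≤ Real.pi ∧ ‖f t‖ ≤ |phasePart n f (σ + τ) t| := by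
          set c := σ + (n * t + (f t).arg) with hc
          refine ⟨((-c : ℝ) : Real.Angle).toReal, Real.Angle.abs_toReal_le_pi _, ?_⟩
          have h5 : Real.cos (((-c : ℝ) : Real.Angle).toReal + c) = 1 := by
            rw [← Real.Angle.cos_coe, Real.Angle.coe_add, Real.Angle.coe_toReal,
              ← Real.Angle.coe_add, neg_add_cancel, Real.Angle.cos_coe, Real.cos_zero]
          have h6 : σ + ((-c : ℝ) : Real.Angle).toReal + (n * t + (f t).arg) =
              ((-c : ℝ) : Real.Angle).toReal + c := by rw [hc]; ring
          rw [phasePart_eq_norm_mul_cos, h6, h5, mul_one, abs_of_nonneg (norm_nonneg _)]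
        have h3 := norm_le_normOn_top (continuous_phasePart_right (n := n) hf (σ + τ))
          (periodic_phasePart hp _) t
        have h4 := (normOn_phasePart_sub_le hq hn hf hp hD σ hτ).1
        rw [Real.norm_eq_abs] at h3
        linarith
      have := normOn_mono (q := ∞) (f := f) (g := fun _ => X + D)
        (memLp_of_continuous continuous_const _) fun t _ => by
          rw [Real.norm_eq_abs, abs_of_nonneg (by positivity)]; exact hb t
      refine this.trans ?_
      rw [normOn_const le_top (by positivity)]; simp
    rw [normOn_top_cos]
    simp only [ENNReal.div_top, ENNReal.toReal_zero, Real.rpow_zero, div_one, one_mul]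
    rw [abs_le]; constructor <;> linarith
  · have h0 : q ≠ 0 := (zero_lt_one.trans_le hq).ne'
    have hqr : 0 < q.toReal := ENNReal.toReal_pos h0 hq'
    have hinv : (1 / q).toReal = 1 / q.toReal := by simp
    set M := normOn q Real.cos * normOn q f with hM
    have hM0 : 0 ≤ M := mul_nonneg (normOn_nonneg _ _) (normOn_nonneg _ _)
    have hint := lintegral_eLpNorm_phasePart hq hq' (n := n) hf σ
    rw [← ofReal_normOn Real.continuous_cos, ← ofReal_normOn hf,
      ← ENNReal.ofReal_mul (normOn_nonneg _ _), ← hM] at hint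
    simp_rw [← ofReal_normOn (continuous_phasePart_right hf _)] at hint
    have hpi : 0 < 2 * Real.pi := Real.two_pi_pos
    have root : ∀ Z : ℝ, 0 ≤ Z → ENNReal.ofReal Z ^ q.toReal * ENNReal.ofReal (2 * Real.pi) =
        ENNReal.ofReal ((Z * (2 * Real.pi) ^ (1 / q).toReal)) ^ q.toReal := by
      intro Z hZ
      rw [hinv, ENNReal.ofReal_mul hZ, ENNReal.mul_rpow_of_nonneg _ _ hqr.le,
        ENNReal.ofReal_rpow_of_nonneg (x := (2 * Real.pi) ^ (1 / q.toReal)) (by positivity) hqr.le,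
        ← Real.rpow_mul hpi.le, one_div_mul_cancel hqr.ne', Real.rpow_one]
    have hτ : ∀ᵐ τ ∂periodMeasure, |τ| ≤ Real.pi := by
      filter_upwards [ae_restrict_mem measurableSet_Ioc] with τ h
      exact abs_le.2 ⟨h.1.le, h.2⟩
    -- For every τ in the period the norm at phase σ + τ lies between X - D and X + D; integrating
    -- the q-th powers compares these constants with M.
    have hup : ENNReal.ofReal M ^ q.toReal ≤
        ENNReal.ofReal ((X + D) * (2 * Real.pi) ^ (1 / q).toReal) ^ q.toReal := by
      rw [← hint, ← root _ (by positivity), ← periodMeasure_univ, ← lintegral_const]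
      refine lintegral_mono_ae ?_
      filter_upwards [hτ] with τ h
      gcongr
      exact (normOn_phasePart_sub_le hq hn hf hp hD σ h).1
    -- X - D may be negative, so it is truncated at 0 before taking powers.
    have hlow : ENNReal.ofReal (max (X - D) 0 * (2 * Real.pi) ^ (1 / q).toReal) ^ q.toReal ≤
        ENNReal.ofReal M ^ q.toReal := by
      rw [← hint, ← root _ (le_max_right _ _), ← periodMeasure_univ, ← lintegral_const]
      refine lintegral_mono_ae ?_
      filter_upwards [hτ] with τ h
      gcongr
      refine max_le ?_ (normOn_nonneg _ _)
      linarith [(normOn_phasePart_sub_le hq hn hf hp hD σ h).2]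
    rw [ENNReal.rpow_le_rpow_iff hqr, ENNReal.ofReal_le_ofReal_iff (by positivity)] at hup
    rw [ENNReal.rpow_le_rpow_iff hqr, ENNReal.ofReal_le_ofReal_iff hM0] at hlow
    have hK : 0 < (2 * Real.pi) ^ (1 / q).toReal := by positivity
    have e : normOn q Real.cos / (2 * Real.pi) ^ (1 / q).toReal * normOn q f =
        M / (2 * Real.pi) ^ (1 / q).toReal := by rw [hM]; ring
    rw [e, abs_le]
    have h1 := (div_le_iff₀ hK).2 hup
    have h2 := (le_div_iff₀ hK).2 hlow
    have h3 := le_max_left (X - D) 0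
    constructor <;> linarith

/-! ### The norm of the Cauchy kernel -/

lemma map_abs_restrict_Ioc {c : ℝ} (hc : 0 < c) :
    (volume.restrict (Set.Ioc (-c) c)).map (fun t => |t|) =
      (2 : ℝ≥0∞) • volume.restrict (Set.Icc 0 c) := by
  have hu : Set.Ioc (-c) c = Set.Ioc (-c) 0 ∪ Set.Ioc 0 c :=
    (Set.Ioc_union_Ioc_eq_Ioc (by linarith) hc.le).symm
  have hd : Disjoint (Set.Ioc (-c) 0) (Set.Ioc 0 c) := by
    rw [Set.disjoint_left]; intro x hx hy; exact absurd hx.2 (not_le.2 hy.1)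
  rw [hu, Measure.restrict_union hd measurableSet_Ioc, Measure.map_add _ _ (by fun_prop)]
  have h1 : (volume.restrict (Set.Ioc 0 c)).map (fun t : ℝ => |t|) =
      volume.restrict (Set.Icc 0 c) := by
    rw [Measure.map_congr (g := id), Measure.map_id, Measure.restrict_congr_set Ioc_ae_eq_Icc]
    filter_upwards [ae_restrict_mem measurableSet_Ioc] with x hx
    exact abs_of_pos hx.1
  have h2 : (volume.restrict (Set.Ioc (-c) 0)).map (fun t : ℝ => |t|) =
      volume.restrict (Set.Icc 0 c) := by
    rw [Measure.map_congr (g := fun t => -t)]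
    · have hpre : Set.Ioc (-c) 0 = (fun t : ℝ => -t) ⁻¹' (Set.Ico 0 c) := by
        ext x; simp only [Set.mem_Ioc, Set.mem_preimage, Set.mem_Ico]
        constructor <;> rintro ⟨h, h'⟩ <;> constructor <;> linarith
      rw [hpre, ← Measure.restrict_map measurable_neg measurableSet_Ico, Measure.map_neg_eq_self,
        Measure.restrict_congr_set Ico_ae_eq_Icc]
    · filter_upwards [ae_restrict_mem measurableSet_Ioc] with x hx
      exact abs_of_nonpos hx.2
  rw [h1, h2, two_smul]

lemma map_div_restrict_Icc {a c : ℝ} (ha : 0 < a) :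
    (volume.restrict (Set.Icc 0 c)).map (fun t => a⁻¹ * t) =
      ENNReal.ofReal a • volume.restrict (Set.Icc 0 (c / a)) := by
  have hpre : Set.Icc 0 c = (fun t : ℝ => a⁻¹ * t) ⁻¹' (Set.Icc 0 (c / a)) := by
    ext x
    simp only [Set.mem_preimage, Set.mem_Icc, div_eq_inv_mul]
    rw [mul_nonneg_iff_of_pos_left (inv_pos.2 ha), mul_le_mul_iff_right₀ (inv_pos.2 ha)]
  rw [hpre, ← Measure.restrict_map (by fun_prop) measurableSet_Icc,
    Real.map_volume_mul_left (inv_pos.2 ha).ne', inv_inv, abs_of_pos ha, Measure.restrict_smul]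

/-- Evenness contributes 2^{1/q} and the substitution t = a u contributes a^{1/q}, on top of the
factor 1/a of the kernel. The pushforward form treats q = ∞ together with finite q. -/
lemma normOn_cauchyKernel {a : ℝ} (ha : 0 < a) {q : ℝ≥0∞} :
    normOn q (cauchyKernel a) =
      2 ^ (1 / q).toReal * (a ^ ((1 / q).toReal - 1) * J q (Real.pi / a)) := by
  set k : ℝ → ℝ := fun t => 1 / Real.sqrt (t ^ 2 + 1) with hk
  have hkc : Continuous k := by
    refine Continuous.div (by fun_prop) (by fun_prop) fun t => ?_
    positivity
  have hpt : ∀ t, ‖cauchyKernel a t‖ = a⁻¹ * k (a⁻¹ * |t|) := by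
    intro t
    have : a ^ 2 + t ^ 2 = a ^ 2 * ((a⁻¹ * |t|) ^ 2 + 1) := by
      rw [mul_pow, sq_abs]; field_simp; ring
    rw [norm_cauchyKernel, this, Real.sqrt_mul (by positivity), Real.sqrt_sq ha.le, hk]
    field_simp
  have he : eLpNorm (fun t => k (a⁻¹ * |t|)) q periodMeasure =
      2 ^ (1 / q).toReal * (ENNReal.ofReal a ^ (1 / q).toReal *
        eLpNorm k q (volume.restrict (Set.Icc 0 (Real.pi / a)))) := by
    have h1 : (fun t => k (a⁻¹ * |t|)) = (fun t => k (a⁻¹ * t)) ∘ fun t : ℝ => |t| := rfl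
    have h2 : (fun t => k (a⁻¹ * t)) = k ∘ fun t : ℝ => a⁻¹ * t := rfl
    have hk2 : Continuous fun t => k (a⁻¹ * t) := hkc.comp (by fun_prop)
    rw [h1, ← eLpNorm_map_measure hk2.aestronglyMeasurable (by fun_prop),
      map_abs_restrict_Ioc Real.pi_pos, eLpNorm_smul_measure_of_ne_zero (by norm_num), h2,
      ← eLpNorm_map_measure hkc.aestronglyMeasurable (by fun_prop), map_div_restrict_Icc ha,
      eLpNorm_smul_measure_of_ne_zero (by simpa using ha), smul_eq_mul, smul_eq_mul]
  rw [← normOn_norm]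
  simp_rw [hpt]
  rw [normOn_const_mul, normOn, he, ENNReal.toReal_mul, ENNReal.toReal_mul, ← ENNReal.toReal_rpow,
    ← ENNReal.toReal_rpow, ENNReal.toReal_ofReal ha.le, abs_of_pos (inv_pos.2 ha),
    Real.rpow_sub_one ha.ne', J, ← hk]
  simp only [ENNReal.toReal_ofNat]
  field_simp

/-! ### The remainder series in L_q -/

section Approximation

variable {α r : ℝ} {n : ℕ} {q : ℝ≥0∞}

/-- Replacing R by the geometric kernel at t + s and at t costs 2 + (2/A)|G| each, and shifting G
costs (2/a)(π/n)|G| ≤ (8/A)|G|. The constant 4 has norm at most 8π, and 12/A becomes 24/A when G is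
bounded by twice the Cauchy kernel. -/
lemma normOn_remainderSeries_shift_le (hα : 0 < α) (hr₀ : 0 < r) (hr₁ : r < 1) (hn : 1 ≤ n)
    (hA : 2 ≤ α * r * (n : ℝ) ^ r) (ha₁ : α * r * (n : ℝ) ^ r / n ≤ 1 / 14) (hq : 1 ≤ q) :
    ShiftBound q n (remainderSeries α r n) (8 * Real.pi + 24 / (α * r * (n : ℝ) ^ r) *
      normOn q (cauchyKernel (α * r * (n : ℝ) ^ r / n))) := by
  intro s hs
  have hn0 : (0 : ℝ) < n := by exact_mod_cast hn
  set A := α * r * (n : ℝ) ^ r with hAdef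
  have hA0 : 0 < A := by linarith
  set a := A / n with ha
  have ha0 : 0 < a := by rw [ha]; positivity
  have hF := continuous_remainderSeries hα hn hA
  have hG := continuous_geomKernel ha0
  have hGs : Continuous fun t => geomKernel a (t + s) := hG.comp (by fun_prop)
  have hpt : ∀ t, ‖remainderSeries α r n (t + s) - remainderSeries α r n t‖ ≤
      (4 + 2 / A * ‖geomKernel a (t + s)‖) + 10 / A * ‖geomKernel a t‖ := by
    intro t
    have h1 := norm_remainderSeries_sub_geomKernel_le hα hr₀ hr₁ hn hA ha₁ (t + s)
    have h2 := norm_remainderSeries_sub_geomKernel_le hα hr₀ hr₁ hn hA ha₁ t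
    have h3 := norm_geomKernel_add_sub_le ha0 ha₁ t s
    rw [← hAdef, ← ha] at h1 h2
    have h4 : 2 / a * |s| ≤ 8 / A := by
      calc 2 / a * |s| ≤ 2 / a * (Real.pi / n) := by gcongr
        _ = 2 * Real.pi / A := by rw [ha]; field_simp
        _ ≤ 8 / A := by gcongr; linarith [Real.pi_le_four]
    have h5 : ‖geomKernel a (t + s) - geomKernel a t‖ ≤ 8 / A * ‖geomKernel a t‖ :=
      h3.trans (by gcongr)
    have e : remainderSeries α r n (t + s) - remainderSeries α r n t =
        (remainderSeries α r n (t + s) - geomKernel a (t + s)) -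
          (remainderSeries α r n t - geomKernel a t) +
          (geomKernel a (t + s) - geomKernel a t) := by ring
    rw [e]
    refine (norm_add_le _ _).trans ((add_le_add_left (norm_sub_le _ _) _).trans ?_)
    have e3 : 10 / A * ‖geomKernel a t‖ =
      2 / A * ‖geomKernel a t‖ + 8 / A * ‖geomKernel a t‖ := by ring
    linarith
  have hK : normOn q (geomKernel a) ≤ 2 * normOn q (cauchyKernel a) := by
    have h2 := normOn_const_mul q 2 fun t => ‖cauchyKernel a t‖
    rw [normOn_norm, abs_of_pos two_pos] at h2
    rw [← h2]
    refine normOn_mono (memLp_of_continuous ?_ q) fun t ht => ?_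
    · have := continuous_cauchyKernel ha0
      fun_prop
    · rw [Real.norm_eq_abs, abs_of_nonneg (by positivity)]
      exact norm_geomKernel_le ha0 ha₁ (abs_le.2 ⟨ht.1.le, ht.2⟩)
  have hm1 : MemLp (fun t => 2 / A * ‖geomKernel a (t + s)‖) q periodMeasure :=
    memLp_of_continuous (by fun_prop) q
  have hm2 : MemLp (fun t => 10 / A * ‖geomKernel a t‖) q periodMeasure :=
    memLp_of_continuous (by fun_prop) q
  have hm3 : MemLp (fun t => 4 + 2 / A * ‖geomKernel a (t + s)‖) q periodMeasure :=
    memLp_of_continuous (by fun_prop) q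
  have hstep := normOn_le_add hq hm3 hm2
    (f := fun t => remainderSeries α r n (t + s) - remainderSeries α r n t) fun t _ => by
      rw [Real.norm_eq_abs, Real.norm_eq_abs, abs_of_nonneg (by positivity),
        abs_of_nonneg (by positivity)]
      exact hpt t
  have hstep2 := normOn_le_add hq (memLp_of_continuous (continuous_const (y := (4 : ℝ))) q) hm1
    (f := fun t => 4 + 2 / A * ‖geomKernel a (t + s)‖) fun t _ => by
      rw [Real.norm_eq_abs, Real.norm_eq_abs, Real.norm_eq_abs, abs_of_nonneg (by positivity),
        abs_of_nonneg (by positivity), abs_of_nonneg (by positivity)]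
  rw [normOn_const_mul, normOn_norm, abs_of_pos (by positivity)] at hstep
  rw [normOn_const_mul, normOn_norm q (fun t => geomKernel a (t + s)),
    normOn_comp_add hG.stronglyMeasurable (periodic_geomKernel a), abs_of_pos (by positivity)]
    at hstep2
  have h4 := normOn_const_le hq (c := 4) (by norm_num)
  calc _ ≤ 8 * Real.pi + 12 / A * normOn q (geomKernel a) := by
        have : 12 / A * normOn q (geomKernel a) =
          2 / A * normOn q (geomKernel a) + 10 / A * normOn q (geomKernel a) := by ring
        linarith
    _ ≤ 8 * Real.pi + 12 / A * (2 * normOn q (cauchyKernel a)) := by gcongr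
    _ = _ := by ring

lemma abs_normOn_remainderSeries_sub_le (hα : 0 < α) (hr₀ : 0 < r) (hr₁ : r < 1) (hn : 1 ≤ n)
    (hA : 2 ≤ α * r * (n : ℝ) ^ r) (ha₁ : α * r * (n : ℝ) ^ r / n ≤ 1 / 14) (hq : 1 ≤ q) :
    |normOn q (remainderSeries α r n) - normOn q (cauchyKernel (α * r * (n : ℝ) ^ r / n))| ≤
      16 * Real.pi + 4 / (α * r * (n : ℝ) ^ r) *
        normOn q (cauchyKernel (α * r * (n : ℝ) ^ r / n)) := by
  have hn0 : (0 : ℝ) < n := by exact_mod_cast hn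
  set A := α * r * (n : ℝ) ^ r with hAdef
  have hA0 : 0 < A := by linarith
  set a := A / n with ha
  have ha0 : 0 < a := by rw [ha]; positivity
  have hF := continuous_remainderSeries hα hn hA
  have hH := continuous_cauchyKernel ha0
  have hpt : ∀ t ∈ Set.Ioc (-Real.pi) Real.pi,
      ‖remainderSeries α r n t - cauchyKernel a t‖ ≤ 8 + 4 / A * ‖cauchyKernel a t‖ := by
    intro t ht
    have ht' : |t| ≤ Real.pi := abs_le.2 ⟨ht.1.le, ht.2⟩
    have h2 := norm_remainderSeries_sub_geomKernel_le hα hr₀ hr₁ hn hA ha₁ t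
    have h3 := norm_geomKernel_sub_cauchyKernel_le ha0 ha₁ ht'
    have h4 := norm_geomKernel_le ha0 ha₁ ht'
    rw [← hAdef, ← ha] at h2
    have h5 : 2 / A * ‖geomKernel a t‖ ≤ 2 / A * (2 * ‖cauchyKernel a t‖) := by gcongr
    have h6 := norm_sub_le_norm_sub_add_norm_sub (remainderSeries α r n t) (geomKernel a t)
      (cauchyKernel a t)
    have h7 : 2 / A * (2 * ‖cauchyKernel a t‖) = 4 / A * ‖cauchyKernel a t‖ := by ring
    linarith
  have hm1 : MemLp (fun t => 4 / A * ‖cauchyKernel a t‖) q periodMeasure :=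
    memLp_of_continuous (by fun_prop) q
  have hdiff : normOn q (fun t => remainderSeries α r n t - cauchyKernel a t) ≤
      16 * Real.pi + 4 / A * normOn q (cauchyKernel a) := by
    have h := normOn_le_add hq (memLp_of_continuous (continuous_const (y := (8 : ℝ))) q) hm1
      (f := fun t => remainderSeries α r n t - cauchyKernel a t) fun t ht => by
        rw [Real.norm_eq_abs, Real.norm_eq_abs, abs_of_nonneg (by positivity),
          abs_of_nonneg (by positivity)]
        exact hpt t ht
    rw [normOn_const_mul, normOn_norm, abs_of_pos (by positivity)] at h
    have h4 := normOn_const_le hq (c := 8) (by norm_num)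
    linarith
  have hd : MemLp (fun t => remainderSeries α r n t - cauchyKernel a t) q periodMeasure :=
    memLp_of_continuous (by fun_prop) q
  have h1 := normOn_le_add hq (memLp_of_continuous hH q) hd (f := remainderSeries α r n)
    fun t _ => by
      have := norm_add_le (cauchyKernel a t) (remainderSeries α r n t - cauchyKernel a t)
      rwa [add_sub_cancel] at this
  have h2 := normOn_le_add hq (memLp_of_continuous hF q) hd (f := cauchyKernel a)
    fun t _ => by
      have := norm_sub_le (remainderSeries α r n t) (remainderSeries α r n t - cauchyKernel a t)
      rwa [sub_sub_cancel] at this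
  rw [abs_le]
  constructor <;> linarith

end Approximation

/-! ### Near-extremal functions for the duality of L_p and L_q -/

/-- The sign of a real number, with value `1` at `0`. -/
noncomputable def posSign (x : ℝ) : ℝ := if 0 ≤ x then 1 else -1

lemma measurable_posSign : Measurable posSign :=
  Measurable.ite measurableSet_Ici measurable_const measurable_const

lemma mul_posSign (x : ℝ) : x * posSign x = |x| := by
  unfold posSign
  split_ifs with h
  · rw [mul_one, abs_of_nonneg h]
  · rw [abs_of_neg (not_le.1 h)]; ring

lemma abs_posSign (x : ℝ) : |posSign x| = 1 := by
  unfold posSign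
  split_ifs <;> simp

/-- The supremum need not be attained in L_1, hence the loss ε. The function is the sign of g on the
set where |g| > M - ε, divided by the measure of that set within one period. -/
lemma exists_dual_top {g : ℝ → ℝ} (hg : Continuous g) (hp : Function.Periodic g (2 * Real.pi))
    {ε : ℝ} (hε : 0 < ε) :
    ∃ ψ : ℝ → ℝ, Measurable ψ ∧ Function.Periodic ψ (2 * Real.pi) ∧
      eLpNorm ψ 1 periodMeasure ≤ 1 ∧ normOn ∞ g - ε ≤ ∫ t, g t * ψ t ∂periodMeasure := by
  set M := normOn ∞ g with hM
  set S : Set ℝ := {t | M - ε < |g t|} with hS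
  have hSm : MeasurableSet S := measurableSet_lt measurable_const hg.abs.measurable
  have hSpos : periodMeasure S ≠ 0 := by
    intro h0
    have hae : ∀ᵐ t ∂periodMeasure, ‖g t‖ ≤ M - ε := by
      rw [ae_iff]
      simpa [hS] using h0
    have hne : (ae periodMeasure).NeBot := by
      rw [ae_neBot]
      intro h
      have := congrArg (fun m : Measure ℝ => m Set.univ) h
      simp only [periodMeasure_univ] at this
      simp at this; linarith [Real.pi_pos]
    obtain ⟨t, ht⟩ := hae.exists
    have hnn : 0 ≤ M - ε := (norm_nonneg _).trans ht
    have h1 : eLpNorm g ∞ periodMeasure ≤ ENNReal.ofReal (M - ε) := by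
      rw [eLpNorm_exponent_top]
      exact eLpNormEssSup_le_of_ae_bound hae
    have h2 : M ≤ M - ε := by
      rw [hM, normOn] at *
      exact ENNReal.toReal_le_of_le_ofReal hnn h1
    linarith
  have hSfin : periodMeasure S ≠ ∞ := measure_ne_top _ _
  set v := (periodMeasure S).toReal with hv
  have hv0 : 0 < v := ENNReal.toReal_pos hSpos hSfin
  set ψ : ℝ → ℝ := S.indicator fun t => posSign (g t) / v with hψ
  have hψm : Measurable ψ := ((measurable_posSign.comp hg.measurable).div_const v).indicator hSm
  have hper : Function.Periodic ψ (2 * Real.pi) := by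
    intro t
    simp only [hψ, hS, Set.indicator, Set.mem_ofPred_eq, hp t]
  have hψb : ∀ t, ‖ψ t‖ ≤ v⁻¹ := by
    intro t
    simp only [hψ, Set.indicator]
    split_ifs
    · rw [norm_div, Real.norm_eq_abs, abs_posSign, Real.norm_eq_abs, abs_of_pos hv0, one_div]
    · simp [hv0.le]
  refine ⟨ψ, hψm, hper, ?_, ?_⟩
  · rw [eLpNorm_one_eq_lintegral_enorm]
    have h1 : ∀ t, ‖ψ t‖ₑ = S.indicator (fun _ => (periodMeasure S)⁻¹) t := by
      intro t
      simp only [hψ, Set.indicator]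
      split_ifs
      · rw [← ofReal_norm, norm_div, Real.norm_eq_abs, abs_posSign, Real.norm_eq_abs,
          abs_of_pos hv0, one_div, ENNReal.ofReal_inv_of_pos hv0, hv,
          ENNReal.ofReal_toReal hSfin]
      · simp
    simp_rw [h1]
    rw [lintegral_indicator_const hSm, ENNReal.inv_mul_cancel hSpos hSfin]
  · have hint : Integrable (fun t => g t * ψ t) periodMeasure := by
      have hgi : Integrable g periodMeasure :=
        memLp_one_iff_integrable.1 (memLp_of_continuous hg 1)
      exact hgi.mul_bdd (c := v⁻¹) hψm.aestronglyMeasurable (Filter.Eventually.of_forall hψb)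
    have h2 : ∫ t, S.indicator (fun _ => (M - ε) / v) t ∂periodMeasure = M - ε := by
      rw [integral_indicator_const _ hSm, measureReal_def, ← hv, smul_eq_mul]
      field_simp
    rw [← h2]
    refine integral_mono ((integrable_const _).indicator hSm) hint fun t => ?_
    simp only [hψ, Set.indicator]
    split_ifs with ht
    · rw [← mul_div_assoc, mul_posSign]
      have : M - ε < |g t| := ht
      gcongr
    · simp

lemma exists_dual_of_ne_top {g : ℝ → ℝ} (hg : Continuous g)
    (hp : Function.Periodic g (2 * Real.pi)) {p q : ℝ≥0∞} (hq : 1 ≤ q) (hq' : q ≠ ∞)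
    [hpq : ENNReal.HolderConjugate p q] :
    ∃ ψ : ℝ → ℝ, Measurable ψ ∧ Function.Periodic ψ (2 * Real.pi) ∧
      eLpNorm ψ p periodMeasure ≤ 1 ∧ normOn q g ≤ ∫ t, g t * ψ t ∂periodMeasure := by
  set M := normOn q g with hM
  rcases (normOn_nonneg q g).eq_or_lt with h0 | hM0
  · exact ⟨0, measurable_const, fun _ => rfl, by simp, by rw [hM, ← h0]; simp⟩
  have hq0 : q ≠ 0 := (zero_lt_one.trans_le hq).ne'
  have hqr : 0 < q.toReal := ENNReal.toReal_pos hq0 hq'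
  have hq1 : 1 ≤ q.toReal := by
    rw [← ENNReal.toReal_one]; exact ENNReal.toReal_mono hq' hq
  set s := q.toReal with hs
  -- The equality case of Hölder's inequality. Its p-th power is |g|^s / M^s because (s - 1) p = s;
  -- for s = 1 it reduces to the sign of g.
  set ψ : ℝ → ℝ := fun t => (|g t| ^ (s - 1) / M ^ (s - 1)) * posSign (g t) with hψ
  have hrc : Continuous fun t => |g t| ^ (s - 1) :=
    hg.abs.rpow_const fun t => Or.inr (by linarith)
  have hsc : Continuous fun t => |g t| ^ s := hg.abs.rpow_const fun t => Or.inr hqr.le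
  have hψm : Measurable ψ := (hrc.measurable.div_const _).mul (measurable_posSign.comp hg.measurable)
  have hnorm : ∀ t, ‖ψ t‖ = |g t| ^ (s - 1) / M ^ (s - 1) := by
    intro t
    rw [hψ, norm_mul, Real.norm_eq_abs, Real.norm_eq_abs, abs_posSign, mul_one, abs_of_nonneg]
    positivity
  have hMs : ∫ t, |g t| ^ s ∂periodMeasure = M ^ s := by
    have h := (memLp_of_continuous hg q).eLpNorm_eq_integral_rpow_norm hq0 hq'
    have h2 : 0 ≤ ∫ t, |g t| ^ s ∂periodMeasure := integral_nonneg fun t => by positivity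
    rw [hM, normOn, h, ENNReal.toReal_ofReal (by positivity)]
    simp only [Real.norm_eq_abs]
    rw [← hs, ← Real.rpow_mul h2, inv_mul_cancel₀ hqr.ne', Real.rpow_one]
  have hsi : Integrable (fun t => |g t| ^ s) periodMeasure :=
    memLp_one_iff_integrable.1 (memLp_of_continuous hsc 1)
  refine ⟨ψ, hψm, fun t => by simp only [hψ, hp t], ?_, ?_⟩
  · rcases eq_or_ne p ∞ with rfl | hp'
    · have hq1' : q = 1 := by
        have : 1 = q⁻¹ := by simpa using hpq.one_div_eq
        exact ENNReal.inv_eq_one.1 this.symm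
      have : s = 1 := by rw [hs, hq1']; simp
      rw [eLpNorm_exponent_top]
      have hb : ∀ᵐ t ∂periodMeasure, ‖ψ t‖ ≤ 1 :=
        Filter.Eventually.of_forall fun t => by rw [hnorm, this]; simp
      simpa using eLpNormEssSup_le_of_ae_bound hb
    · have hp1 : 1 ≤ p := hpq.one_le
      have hp0 : p ≠ 0 := (zero_lt_one.trans_le hp1).ne'
      have hpr : 0 < p.toReal := ENNReal.toReal_pos hp0 hp'
      have hconj : (s - 1) * p.toReal = s := by
        have h := hpq.inv_add_inv_eq_inv
        have h2 := congrArg ENNReal.toReal h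
        rw [ENNReal.toReal_add (by simpa using hp0) (by simpa using hq0)] at h2
        simp only [ENNReal.toReal_inv, ENNReal.toReal_one, inv_one, ← hs] at h2
        field_simp at h2
        linarith
      have h1 : eLpNorm ψ p periodMeasure ^ p.toReal = 1 := by
        rw [eLpNorm_rpow_toReal hp1 hp']
        have h3 : ∀ t, ‖ψ t‖ₑ ^ p.toReal = ENNReal.ofReal (|g t| ^ s / M ^ s) := by
          intro t
          rw [← ofReal_norm, ENNReal.ofReal_rpow_of_nonneg (norm_nonneg _) hpr.le, hnorm,
            Real.div_rpow (by positivity) (by positivity), ← Real.rpow_mul (abs_nonneg _),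
            ← Real.rpow_mul hM0.le, hconj]
        simp_rw [h3]
        rw [← ofReal_integral_eq_lintegral_ofReal (hsi.div_const _)
          (Filter.Eventually.of_forall fun t => by simp only [Pi.zero_apply]; positivity),
          integral_div, hMs, div_self (by positivity), ENNReal.ofReal_one]
      rw [← ENNReal.rpow_le_rpow_iff hpr, h1, ENNReal.one_rpow]
  · have h4 : ∀ t, g t * ψ t = |g t| ^ s / M ^ (s - 1) := by
      intro t
      have : g t * ψ t = |g t| ^ (s - 1) * (g t * posSign (g t)) / M ^ (s - 1) := by
        rw [hψ]; ring
      rw [this, mul_posSign]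
      rcases (abs_nonneg (g t)).eq_or_lt with h | h
      · rw [← h]; simp [Real.zero_rpow hqr.ne']
      · rw [← Real.rpow_add_one h.ne', sub_add_cancel]
    simp_rw [h4]
    rw [integral_div, hMs, ← Real.rpow_sub hM0, sub_sub_cancel, Real.rpow_one]

lemma exists_dual {g : ℝ → ℝ} (hg : Continuous g) (hp : Function.Periodic g (2 * Real.pi))
    {p q : ℝ≥0∞} [hpq : ENNReal.HolderConjugate p q] {ε : ℝ} (hε : 0 < ε) :
    ∃ ψ : ℝ → ℝ, Measurable ψ ∧ Function.Periodic ψ (2 * Real.pi) ∧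
      eLpNorm ψ p periodMeasure ≤ 1 ∧ normOn q g - ε ≤ ∫ t, g t * ψ t ∂periodMeasure := by
  rcases eq_or_ne q ∞ with rfl | hq'
  · have hp1 : p = 1 := by
      have : 1 = p⁻¹ := by simpa using hpq.one_div_eq
      exact ENNReal.inv_eq_one.1 this.symm
    rw [hp1]
    exact exists_dual_top hg hp hε
  · obtain ⟨ψ, h1, h2, h3, h4⟩ := exists_dual_of_ne_top hg hp (p := p) hpq.symm.one_le hq'
    exact ⟨ψ, h1, h2, h3, by linarith⟩

/-! ### Orthogonality and Fourier sums of absolutely convergent series -/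

lemma integral_period_eq (f : ℝ → ℝ) :
    ∫ t in (-Real.pi)..Real.pi, f t = ∫ t, f t ∂periodMeasure :=
  intervalIntegral.integral_of_le (by linarith [Real.pi_pos])

lemma integrable_period_of_continuous {f : ℝ → ℝ} (hf : Continuous f) :
    Integrable f periodMeasure :=
  memLp_one_iff_integrable.1 (memLp_of_continuous hf 1)

lemma integral_period_cos_int (m : ℤ) :
    ∫ t, Real.cos (m * t) ∂periodMeasure = if m = 0 then 2 * Real.pi else 0 := by
  rw [← integral_period_eq]
  split_ifs with h
  · simp [h]; ring
  · have hm : (m : ℝ) ≠ 0 := by exact_mod_cast h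
    rw [intervalIntegral.integral_comp_mul_left (fun x => Real.cos x) hm, integral_cos]
    simp [Real.sin_int_mul_pi]

lemma integral_period_sin_int (m : ℤ) : ∫ t, Real.sin (m * t) ∂periodMeasure = 0 := by
  rw [← integral_period_eq]
  rcases eq_or_ne m 0 with h | h
  · simp [h]
  · have hm : (m : ℝ) ≠ 0 := by exact_mod_cast h
    rw [intervalIntegral.integral_comp_mul_left (fun x => Real.sin x) hm, integral_sin]
    simp

lemma integral_period_cos_mul_cos (j k : ℕ) :
    ∫ t, Real.cos (j * t) * Real.cos (k * t) ∂periodMeasure =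
      if j = k then (if j = 0 then 2 * Real.pi else Real.pi) else 0 := by
  have h : ∀ t : ℝ, Real.cos (j * t) * Real.cos (k * t) =
      (1 / 2) * Real.cos (((j : ℤ) - (k : ℤ) : ℤ) * t) +
        (1 / 2) * Real.cos (((j : ℤ) + (k : ℤ) : ℤ) * t) := by
    intro t
    push_cast
    rw [sub_mul, add_mul, Real.cos_sub, Real.cos_add]; ring
  simp_rw [h]
  rw [integral_add (integrable_period_of_continuous (by fun_prop))
    (integrable_period_of_continuous (by fun_prop)), integral_const_mul, integral_const_mul,
    integral_period_cos_int, integral_period_cos_int]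
  rcases eq_or_ne j k with rfl | hjk
  · rcases eq_or_ne j 0 with rfl | hj
    · simp; ring
    · have : (j : ℤ) + j ≠ 0 := by omega
      simp [hj, this]
  · have h1 : (j : ℤ) - k ≠ 0 := by omega
    have h2 : (j : ℤ) + k ≠ 0 := by omega
    simp only [h1, h2, hjk, if_false]; ring

lemma integral_period_sin_mul_sin (j k : ℕ) :
    ∫ t, Real.sin (j * t) * Real.sin (k * t) ∂periodMeasure =
      if j = k then (if j = 0 then 0 else Real.pi) else 0 := by
  have h : ∀ t : ℝ, Real.sin (j * t) * Real.sin (k * t) =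
      (1 / 2) * Real.cos (((j : ℤ) - (k : ℤ) : ℤ) * t) -
        (1 / 2) * Real.cos (((j : ℤ) + (k : ℤ) : ℤ) * t) := by
    intro t
    push_cast
    rw [sub_mul, add_mul, Real.cos_sub, Real.cos_add]; ring
  simp_rw [h]
  rw [integral_sub (integrable_period_of_continuous (by fun_prop))
    (integrable_period_of_continuous (by fun_prop)), integral_const_mul, integral_const_mul,
    integral_period_cos_int, integral_period_cos_int]
  rcases eq_or_ne j k with rfl | hjk
  · rcases eq_or_ne j 0 with rfl | hj
    · simp
    · have : (j : ℤ) + j ≠ 0 := by omega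
      simp [hj, this]
  · have h1 : (j : ℤ) - k ≠ 0 := by omega
    have h2 : (j : ℤ) + k ≠ 0 := by omega
    simp only [h1, h2, hjk, if_false]; ring

lemma integral_period_sin_mul_cos (j k : ℕ) :
    ∫ t, Real.sin (j * t) * Real.cos (k * t) ∂periodMeasure = 0 := by
  have h : ∀ t : ℝ, Real.sin (j * t) * Real.cos (k * t) =
      (1 / 2) * Real.sin (((j : ℤ) - (k : ℤ) : ℤ) * t) +
        (1 / 2) * Real.sin (((j : ℤ) + (k : ℤ) : ℤ) * t) := by
    intro t
    push_cast
    rw [sub_mul, add_mul, Real.sin_sub, Real.sin_add]; ring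
  simp_rw [h]
  rw [integral_add (integrable_period_of_continuous (by fun_prop))
    (integrable_period_of_continuous (by fun_prop)), integral_const_mul, integral_const_mul,
    integral_period_sin_int, integral_period_sin_int]
  simp

lemma integral_period_bdd_mul_tsum {u : ℝ → ℝ} (hu : Integrable u periodMeasure)
    {F : ℕ → ℝ → ℝ} (hF : ∀ k, Continuous (F k)) {c : ℕ → ℝ} (hc : Summable c)
    (hb : ∀ k t, |F k t| ≤ c k) :
    HasSum (fun k => ∫ t, F k t * u t ∂periodMeasure)
      (∫ t, (∑' k, F k t) * u t ∂periodMeasure) := by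
  have hint : ∀ k, Integrable (fun t => F k t * u t) periodMeasure := fun k =>
    hu.bdd_mul (c := c k) (hF k).aestronglyMeasurable (Filter.Eventually.of_forall (hb k))
  have hs : Summable fun k => ∫ t, ‖F k t * u t‖ ∂periodMeasure := by
    refine Summable.of_nonneg_of_le (fun k => integral_nonneg fun t => norm_nonneg _) (fun k => ?_)
      (hc.mul_right (∫ t, ‖u t‖ ∂periodMeasure))
    rw [← integral_const_mul]
    refine integral_mono (hint k).norm (hu.norm.const_mul _) fun t => ?_
    simp only [norm_mul]
    exact mul_le_mul_of_nonneg_right (hb k t) (norm_nonneg _)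
  have h := hasSum_integral_of_summable_integral_norm hint hs
  simpa only [tsum_mul_right] using h

/-- Fourier coefficients of an absolutely convergent trigonometric series. -/
lemma fourierSum_of_eq_tsum {f : ℝ → ℝ} {a₀ : ℝ} {A B c : ℕ → ℝ} (hc : Summable c)
    (hA : ∀ k, |A k| ≤ c k) (hB : ∀ k, |B k| ≤ c k)
    (hf : ∀ x, f x = a₀ / 2 + ∑' k : ℕ, (A k * Real.cos (((k + 1 : ℕ) : ℝ) * x) +
      B k * Real.sin (((k + 1 : ℕ) : ℝ) * x))) (m : ℕ) (x : ℝ) :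
    fourierSum f m x = a₀ / 2 + ∑ k ∈ Finset.range m, (A k * Real.cos (((k + 1 : ℕ) : ℝ) * x) +
      B k * Real.sin (((k + 1 : ℕ) : ℝ) * x)) := by
  set F : ℕ → ℝ → ℝ := fun k x => A k * Real.cos (((k + 1 : ℕ) : ℝ) * x) +
      B k * Real.sin (((k + 1 : ℕ) : ℝ) * x) with hF
  have hFc : ∀ k, Continuous (F k) := fun k => by simp only [hF]; fun_prop
  have hFb : ∀ k t, |F k t| ≤ 2 * c k := by
    intro k t
    have h1 := abs_add_le (A k * Real.cos (((k + 1 : ℕ) : ℝ) * t))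
      (B k * Real.sin (((k + 1 : ℕ) : ℝ) * t))
    rw [abs_mul, abs_mul] at h1
    have h2 := mul_le_mul (hA k) (Real.abs_cos_le_one (((k + 1 : ℕ) : ℝ) * t)) (abs_nonneg _)
      ((abs_nonneg _).trans (hA k))
    have h3 := mul_le_mul (hB k) (Real.abs_sin_le_one (((k + 1 : ℕ) : ℝ) * t)) (abs_nonneg _)
      ((abs_nonneg _).trans (hB k))
    simp only [hF]
    linarith
  have hsc : Continuous fun t => ∑' k, F k t :=
    continuous_tsum hFc (hc.mul_left 2) hFb
  -- Termwise integration against a test function; with u a cosine or a sine, orthogonality leaves a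
  -- single term.
  have key : ∀ u : ℝ → ℝ, Continuous u → ∫ t, f t * u t ∂periodMeasure =
      a₀ / 2 * ∫ t, u t ∂periodMeasure + ∑' k, ∫ t, F k t * u t ∂periodMeasure := by
    intro u hu
    have hui := integrable_period_of_continuous hu
    rw [(integral_period_bdd_mul_tsum hui hFc (hc.mul_left 2) hFb).tsum_eq, ← integral_const_mul,
      ← integral_add (hui.const_mul _) (integrable_period_of_continuous (by fun_prop))]
    congr 1; ext t
    rw [hf t]; ring
  have hFcos : ∀ k j : ℕ, ∫ t, F k t * Real.cos (j * t) ∂periodMeasure =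
      if k + 1 = j then A k * Real.pi else 0 := by
    intro k j
    have h : ∀ t, F k t * Real.cos (j * t) =
        A k * (Real.cos (((k + 1 : ℕ) : ℝ) * t) * Real.cos (j * t)) +
          B k * (Real.sin (((k + 1 : ℕ) : ℝ) * t) * Real.cos (j * t)) := by
      intro t; simp only [hF]; ring
    simp_rw [h]
    rw [integral_add (integrable_period_of_continuous (by fun_prop))
      (integrable_period_of_continuous (by fun_prop)), integral_const_mul, integral_const_mul,
      integral_period_cos_mul_cos, integral_period_sin_mul_cos]
    simp
  have hFsin : ∀ k j : ℕ, ∫ t, F k t * Real.sin (j * t) ∂periodMeasure =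
      if k + 1 = j then B k * Real.pi else 0 := by
    intro k j
    have h : ∀ t, F k t * Real.sin (j * t) =
        A k * (Real.sin (j * t) * Real.cos (((k + 1 : ℕ) : ℝ) * t)) +
          B k * (Real.sin (((k + 1 : ℕ) : ℝ) * t) * Real.sin (j * t)) := by
      intro t; simp only [hF]; ring
    simp_rw [h]
    rw [integral_add (integrable_period_of_continuous (by fun_prop))
      (integrable_period_of_continuous (by fun_prop)), integral_const_mul, integral_const_mul,
      integral_period_sin_mul_sin, integral_period_sin_mul_cos]
    simp
  have hpi := Real.pi_pos
  have h0 : cosCoeff f 0 = a₀ := by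
    rw [cosCoeff, integral_period_eq, key _ (by fun_prop)]
    simp_rw [hFcos]
    have := integral_period_cos_int 0
    simp only [Int.cast_zero, if_true] at this
    simp only [Nat.cast_zero, this]
    simp
    field_simp
  have h1 : ∀ j : ℕ, cosCoeff f (j + 1) = A j := by
    intro j
    rw [cosCoeff, integral_period_eq, key _ (by fun_prop)]
    simp_rw [hFcos]
    have h2 := integral_period_cos_int ((j + 1 : ℕ) : ℤ)
    rw [if_neg (by omega)] at h2
    simp only [Int.cast_natCast] at h2
    rw [h2, tsum_eq_single j (fun k hk => if_neg (by omega)), if_pos rfl]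
    field_simp; simp
  have h3 : ∀ j : ℕ, sinCoeff f (j + 1) = B j := by
    intro j
    rw [sinCoeff, integral_period_eq, key _ (by fun_prop)]
    simp_rw [hFsin]
    have h2 := integral_period_sin_int ((j + 1 : ℕ) : ℤ)
    simp only [Int.cast_natCast] at h2
    rw [h2, tsum_eq_single j (fun k hk => if_neg (by omega)), if_pos rfl]
    field_simp; simp
  rw [fourierSum, h0, Finset.range_eq_Ico, Finset.sum_Ico_eq_sum_range]
  congr 1
  rw [← Finset.Ico_add_one_right_eq_Icc, Finset.sum_Ico_eq_sum_range]
  refine Finset.sum_congr (by simp) fun k _ => ?_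
  rw [add_comm 1 k, h1, h3]
  simp

/-! ### The tail of the kernel and the deviation as a convolution -/

/-- The remainder `∑_{k ≥ n} exp (-α k ^ r) cos (k t - β π / 2)` of the kernel. -/
noncomputable def tailKernel (α r β : ℝ) (n : ℕ) (t : ℝ) : ℝ :=
  Real.exp (-α * (n : ℝ) ^ r) *
    phasePart n (remainderSeries α r n) (-(β * Real.pi / 2)) t

section Tail

variable {α r β : ℝ} {n : ℕ}

lemma exp_mul_coeffRatio (α r : ℝ) (n j : ℕ) :
    Real.exp (-α * (n : ℝ) ^ r) * coeffRatio α r n j =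
      Real.exp (-α * ((n + j : ℕ) : ℝ) ^ r) := by
  rw [coeffRatio, ← Real.exp_add]; congr 1; ring

lemma hasSum_tailKernel (hα : 0 < α) (hn : 1 ≤ n) (hA : 2 ≤ α * r * (n : ℝ) ^ r) (t : ℝ) :
    HasSum (fun j : ℕ => Real.exp (-α * ((n + j : ℕ) : ℝ) ^ r) *
      Real.cos (((n + j : ℕ) : ℝ) * t - β * Real.pi / 2)) (tailKernel α r β n t) := by
  have h := (summable_remainderSeries hα hn hA t).hasSum
  have h1 := (h.mul_left (Complex.exp (((n : ℝ) * t + -(β * Real.pi / 2) : ℝ) * Complex.I)))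
  have h2 := (Complex.hasSum_re h1).mul_left (Real.exp (-α * (n : ℝ) ^ r))
  have e : (fun j : ℕ => Real.exp (-α * ((n + j : ℕ) : ℝ) ^ r) *
      Real.cos (((n + j : ℕ) : ℝ) * t - β * Real.pi / 2)) = fun j : ℕ =>
      Real.exp (-α * (n : ℝ) ^ r) *
        (Complex.exp (((n : ℝ) * t + -(β * Real.pi / 2) : ℝ) * Complex.I) *
          ((coeffRatio α r n j : ℂ) * Complex.exp (((j : ℝ) * t : ℝ) * Complex.I))).re := by
    ext j
    have e1 : ((n : ℝ) * t + -(β * Real.pi / 2)) + (j : ℝ) * t =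
        ((n + j : ℕ) : ℝ) * t - β * Real.pi / 2 := by push_cast; ring
    rw [mul_left_comm, ← Complex.exp_add, ← add_mul, ← Complex.ofReal_add, e1,
      Complex.re_ofReal_mul, Complex.exp_ofReal_mul_I_re, ← mul_assoc, exp_mul_coeffRatio]
  rw [e]
  exact h2

lemma summable_kernelCoeff (hα : 0 < α) (hn : 1 ≤ n) (hA : 2 ≤ α * r * (n : ℝ) ^ r) :
    Summable fun k : ℕ => Real.exp (-α * ((k + 1 : ℕ) : ℝ) ^ r) := by
  have h := (summable_coeffRatio hα hn hA).mul_left (Real.exp (-α * (n : ℝ) ^ r))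
  simp_rw [exp_mul_coeffRatio] at h
  have h2 : Summable fun k : ℕ => Real.exp (-α * (k : ℝ) ^ r) := by
    rw [← summable_nat_add_iff n]
    simpa only [add_comm n] using h
  exact (summable_nat_add_iff 1).2 h2

lemma poissonKernel_eq_sum_add_tailKernel (hα : 0 < α) (hn : 1 ≤ n)
    (hA : 2 ≤ α * r * (n : ℝ) ^ r) (t : ℝ) :
    poissonKernel α r β t = ∑ k ∈ Finset.range (n - 1), Real.exp (-α * ((k + 1 : ℕ) : ℝ) ^ r) *
      Real.cos (((k + 1 : ℕ) : ℝ) * t - β * Real.pi / 2) + tailKernel α r β n t := by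
  have hs : Summable fun k : ℕ => Real.exp (-α * ((k + 1 : ℕ) : ℝ) ^ r) *
      Real.cos (((k + 1 : ℕ) : ℝ) * t - β * Real.pi / 2) := by
    refine Summable.of_norm_bounded (summable_kernelCoeff hα hn hA) fun k => ?_
    rw [norm_mul, Real.norm_eq_abs, Real.abs_exp]
    exact mul_le_of_le_one_right (Real.exp_pos _).le (Real.abs_cos_le_one _)
  rw [poissonKernel, ← hs.sum_add_tsum_nat_add (n - 1)]
  congr 1
  rw [← (hasSum_tailKernel hα hn hA t).tsum_eq]
  congr 1; ext j
  have : j + (n - 1) + 1 = n + j := by omega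
  rw [this]

lemma continuous_tailKernel (hα : 0 < α) (hn : 1 ≤ n) (hA : 2 ≤ α * r * (n : ℝ) ^ r) :
    Continuous (tailKernel α r β n) :=
  continuous_const.mul (continuous_phasePart_right (continuous_remainderSeries hα hn hA) _)

lemma periodic_tailKernel (α r β : ℝ) (n : ℕ) :
    Function.Periodic (tailKernel α r β n) (2 * Real.pi) := fun t => by
  rw [tailKernel, tailKernel, periodic_phasePart (periodic_remainderSeries α r n) _ t]

lemma integrable_of_mem_unitBallZero {p : ℝ≥0∞} (hp : 1 ≤ p) {φ : ℝ → ℝ}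
    (hφ : φ ∈ unitBallZero p) : Integrable φ periodMeasure := by
  have : MemLp φ p periodMeasure := ⟨hφ.2.1, hφ.2.2.1.trans_lt ENNReal.one_lt_top⟩
  exact this.integrable hp

/-- The deviation of the Fourier sum is the convolution with the remainder of the kernel. -/
lemma sub_fourierSum_eq (hα : 0 < α) (hn : 1 ≤ n) (hA : 2 ≤ α * r * (n : ℝ) ^ r)
    {f φ : ℝ → ℝ} {a₀ : ℝ} (hφ : Integrable φ periodMeasure)
    (hf : ∀ x, f x = a₀ / 2 + 1 / Real.pi *
      ∫ t in (-Real.pi)..Real.pi, poissonKernel α r β (x - t) * φ t) (x : ℝ) :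
    f x - fourierSum f (n - 1) x =
      1 / Real.pi * ∫ t, tailKernel α r β n (x - t) * φ t ∂periodMeasure := by
  set b := β * Real.pi / 2 with hb
  set c : ℕ → ℝ := fun k => Real.exp (-α * ((k + 1 : ℕ) : ℝ) ^ r) with hc
  have hcs : Summable c := summable_kernelCoeff hα hn hA
  have hc0 : ∀ k, 0 < c k := fun k => Real.exp_pos _
  have hpi := Real.pi_pos
  set K := 1 / Real.pi * ∫ t, ‖φ t‖ ∂periodMeasure with hK
  -- A and B are the Fourier coefficients of f, read off by expanding cos(kx - (kt + b)) under the
  -- integral, with frequency k + 1 at index k.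
  set A : ℕ → ℝ := fun k =>
    c k * (1 / Real.pi * ∫ t, Real.cos (((k + 1 : ℕ) : ℝ) * t + b) * φ t ∂periodMeasure) with hAdef
  set B : ℕ → ℝ := fun k =>
    c k * (1 / Real.pi * ∫ t, Real.sin (((k + 1 : ℕ) : ℝ) * t + b) * φ t ∂periodMeasure) with hBdef
  have hci : ∀ k : ℕ,
      Integrable (fun t => Real.cos (((k + 1 : ℕ) : ℝ) * t + b) * φ t) periodMeasure := fun k =>
    hφ.bdd_mul (c := 1) (Continuous.aestronglyMeasurable (by fun_prop))
      (Filter.Eventually.of_forall fun t => Real.abs_cos_le_one _)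
  have hsi : ∀ k : ℕ,
      Integrable (fun t => Real.sin (((k + 1 : ℕ) : ℝ) * t + b) * φ t) periodMeasure := fun k =>
    hφ.bdd_mul (c := 1) (Continuous.aestronglyMeasurable (by fun_prop))
      (Filter.Eventually.of_forall fun t => Real.abs_sin_le_one _)
  have hbound : ∀ u : ℝ → ℝ, (∀ t, |u t| ≤ 1) →
      |1 / Real.pi * ∫ t, u t * φ t ∂periodMeasure| ≤ K := by
    intro u hu
    rw [abs_mul, abs_of_pos (by positivity), hK]
    gcongr
    rw [← Real.norm_eq_abs]
    refine norm_integral_le_of_norm_le hφ.norm (Filter.Eventually.of_forall fun t => ?_)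
    rw [norm_mul]
    exact mul_le_of_le_one_left (norm_nonneg _) (hu t)
  have hAb : ∀ k, |A k| ≤ c k * K := fun k => by
    rw [hAdef, abs_mul, abs_of_pos (hc0 k)]
    have := hbound (fun t => Real.cos (((k + 1 : ℕ) : ℝ) * t + b)) fun t => Real.abs_cos_le_one _
    exact mul_le_mul_of_nonneg_left this (hc0 k).le
  have hBb : ∀ k, |B k| ≤ c k * K := fun k => by
    rw [hBdef, abs_mul, abs_of_pos (hc0 k)]
    have := hbound (fun t => Real.sin (((k + 1 : ℕ) : ℝ) * t + b)) fun t => Real.abs_sin_le_one _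
    exact mul_le_mul_of_nonneg_left this (hc0 k).le
  set G : ℝ → ℕ → ℝ → ℝ := fun x k t => c k * Real.cos (((k + 1 : ℕ) : ℝ) * (x - t) - b) with hG
  have hGc : ∀ x k, Continuous (G x k) := fun x k => by simp only [hG]; fun_prop
  have hGb : ∀ x k t, |G x k t| ≤ c k := fun x k t => by
    simp only [hG]
    rw [abs_mul, abs_of_pos (hc0 k)]
    exact mul_le_of_le_one_right (hc0 k).le (Real.abs_cos_le_one _)
  have hGi : ∀ x k, Integrable (fun t => G x k t * φ t) periodMeasure := fun x k =>
    hφ.bdd_mul (c := c k) (hGc x k).aestronglyMeasurable (Filter.Eventually.of_forall (hGb x k))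
  have hterm : ∀ x k, 1 / Real.pi * ∫ t, G x k t * φ t ∂periodMeasure =
      A k * Real.cos (((k + 1 : ℕ) : ℝ) * x) + B k * Real.sin (((k + 1 : ℕ) : ℝ) * x) := by
    intro x k
    have h : ∀ t, G x k t * φ t =
        c k * Real.cos (((k + 1 : ℕ) : ℝ) * x) * (Real.cos (((k + 1 : ℕ) : ℝ) * t + b) * φ t) +
        c k * Real.sin (((k + 1 : ℕ) : ℝ) * x) * (Real.sin (((k + 1 : ℕ) : ℝ) * t + b) * φ t) := by
      intro t
      have : ((k + 1 : ℕ) : ℝ) * (x - t) - b =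
        ((k + 1 : ℕ) : ℝ) * x - (((k + 1 : ℕ) : ℝ) * t + b) := by ring
      simp only [hG]
      rw [this, Real.cos_sub]; ring
    simp_rw [h]
    rw [integral_add ((hci k).const_mul _) ((hsi k).const_mul _), integral_const_mul,
      integral_const_mul]
    simp only [hAdef, hBdef]; ring
  have hseries : ∀ x, f x = a₀ / 2 + ∑' k : ℕ, (A k * Real.cos (((k + 1 : ℕ) : ℝ) * x) +
      B k * Real.sin (((k + 1 : ℕ) : ℝ) * x)) := by
    intro x
    have h := (integral_period_bdd_mul_tsum hφ (hGc x) hcs (hGb x)).mul_left (1 / Real.pi)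
    simp_rw [hterm] at h
    rw [hf x, h.tsum_eq, integral_period_eq]
    rfl
  rw [fourierSum_of_eq_tsum (hcs.mul_right K) hAb hBb hseries, hf x, integral_period_eq]
  have hTi : Integrable (fun t => tailKernel α r β n (x - t) * φ t) periodMeasure := by
    obtain ⟨C, hC⟩ : ∃ C, ∀ t, ‖tailKernel α r β n t‖ ≤ C :=
      ⟨_, norm_le_normOn_top (continuous_tailKernel hα hn hA) (periodic_tailKernel α r β n)⟩
    exact hφ.bdd_mul (c := C)
      ((continuous_tailKernel hα hn hA).comp (by fun_prop)).aestronglyMeasurable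
      (Filter.Eventually.of_forall fun t => hC _)
  have hsplit : ∫ t, poissonKernel α r β (x - t) * φ t ∂periodMeasure =
      ∑ k ∈ Finset.range (n - 1), ∫ t, G x k t * φ t ∂periodMeasure +
        ∫ t, tailKernel α r β n (x - t) * φ t ∂periodMeasure := by
    rw [← integral_finsetSum _ fun k _ => hGi x k, ← integral_add
      (integrable_finsetSum _ fun k _ => hGi x k) hTi]
    congr 1; ext t
    rw [poissonKernel_eq_sum_add_tailKernel hα hn hA, add_mul, Finset.sum_mul]
  rw [hsplit, mul_add, Finset.mul_sum]
  simp_rw [hterm]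
  ring

end Tail

/-! ### Upper and lower bounds for the deviation -/

lemma integral_period_comp_add {f : ℝ → ℝ} (hf : Function.Periodic f (2 * Real.pi)) (s : ℝ) :
    ∫ t, f (t + s) ∂periodMeasure = ∫ t, f t ∂periodMeasure := by
  rw [← integral_period_eq, ← integral_period_eq, intervalIntegral.integral_comp_add_right]
  have h := hf.intervalIntegral_add_eq (-Real.pi + s) (-Real.pi)
  have e1 : -Real.pi + s + 2 * Real.pi = Real.pi + s := by ring
  have e2 : -Real.pi + 2 * Real.pi = Real.pi := by ring
  rwa [e1, e2] at h

lemma abs_integral_mul_le_normOn {p q : ℝ≥0∞} [ENNReal.HolderConjugate p q] {g φ : ℝ → ℝ}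
    (hg : Continuous g) (hφ : AEStronglyMeasurable φ periodMeasure)
    (hφ1 : eLpNorm φ p periodMeasure ≤ 1) :
    |∫ t, g t * φ t ∂periodMeasure| ≤ normOn q g := by
  have h1 : ‖∫ t, g t * φ t ∂periodMeasure‖ₑ ≤ eLpNorm g q periodMeasure := by
    calc _ ≤ ∫⁻ t, ‖g t * φ t‖ₑ ∂periodMeasure := enorm_integral_le_lintegral_enorm _
      _ = eLpNorm (g • φ) 1 periodMeasure := by rw [eLpNorm_one_eq_lintegral_enorm]; rfl
      _ ≤ eLpNorm g q periodMeasure * eLpNorm φ p periodMeasure :=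
        eLpNorm_smul_le_mul_eLpNorm hφ hg.aestronglyMeasurable
      _ ≤ eLpNorm g q periodMeasure * 1 := by gcongr
      _ = _ := mul_one _
  rw [← Real.norm_eq_abs, ← toReal_enorm]
  exact ENNReal.toReal_mono (memLp_of_continuous hg q).eLpNorm_ne_top h1

lemma normOn_comp_sub_left {f : ℝ → ℝ} (hf : Continuous f)
    (hp : Function.Periodic f (2 * Real.pi)) (q : ℝ≥0∞) (s : ℝ) :
    normOn q (fun t => f (s - t)) = normOn q f := by
  rw [normOn, eLpNorm_comp_sub_left_of_periodic hf.stronglyMeasurable hp, normOn]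

lemma periodic_poissonKernel (α r β : ℝ) :
    Function.Periodic (poissonKernel α r β) (2 * Real.pi) := by
  intro t
  unfold poissonKernel
  congr 1; ext k; congr 1
  have : ((k + 1 : ℕ) : ℝ) * (t + 2 * Real.pi) - β * Real.pi / 2 =
      ((k + 1 : ℕ) : ℝ) * t - β * Real.pi / 2 + (k + 1 : ℕ) * (2 * Real.pi) := by ring
  rw [this, Real.cos_add_nat_mul_two_pi]

section Deviation

variable {α r β : ℝ} {n : ℕ} {p q : ℝ≥0∞}

lemma fourierDeviation_le (hα : 0 < α) (hn : 1 ≤ n) (hA : 2 ≤ α * r * (n : ℝ) ^ r)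
    [hpq : ENNReal.HolderConjugate p q] :
    fourierDeviation α r β p n ≤
      ENNReal.ofReal (1 / Real.pi * normOn q (tailKernel α r β n)) := by
  have hTc := continuous_tailKernel (β := β) hα hn hA
  have hTp := periodic_tailKernel α r β n
  refine iSup₂_le fun f hf => iSup_le fun x => ?_
  obtain ⟨-, a₀, φ, hφ, hfx⟩ := hf
  show ‖f x - fourierSum f (n - 1) x‖ₑ ≤ _
  rw [sub_fourierSum_eq hα hn hA (integrable_of_mem_unitBallZero hpq.one_le hφ) hfx x,
    Real.enorm_eq_ofReal_abs]
  refine ENNReal.ofReal_le_ofReal ?_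
  rw [abs_mul, abs_of_pos (by positivity)]
  gcongr
  refine (abs_integral_mul_le_normOn (p := p) (q := q) (hTc.comp (by fun_prop)) hφ.2.1
    hφ.2.2.1).trans_eq ?_
  exact normOn_comp_sub_left hTc hTp q x

/-- The dual function ψ need not have mean zero, but (ψ - ψ(· + s)) / 2 does and stays in the unit
ball. Moving the shift onto the reflected tail g, the pairing loses half of the integral of (g + g(·
- s)) ψ, which Hölder controls. The shift s is left free; it is useful when the tail nearly changes
sign under it. -/
lemma le_toReal_fourierDeviation (hα : 0 < α) (hn : 1 ≤ n) (hA : 2 ≤ α * r * (n : ℝ) ^ r)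
    [hpq : ENNReal.HolderConjugate p q] (s : ℝ) :
    1 / Real.pi * (normOn q (tailKernel α r β n) -
      1 / 2 * normOn q (fun t => tailKernel α r β n t + tailKernel α r β n (t + s))) ≤
      (fourierDeviation α r β p n).toReal := by
  have hTc := continuous_tailKernel (β := β) hα hn hA
  have hTp := periodic_tailKernel α r β n
  have hfin : fourierDeviation α r β p n ≠ ∞ :=
    ((fourierDeviation_le hα hn hA (q := q)).trans_lt ENNReal.ofReal_lt_top).ne
  have hpi := Real.pi_pos
  set T := tailKernel α r β n with hT
  set g : ℝ → ℝ := fun t => T (0 - t) with hg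
  have hgc : Continuous g := hTc.comp (by fun_prop)
  have hgp : Function.Periodic g (2 * Real.pi) := fun t => by
    simp only [hg]; rw [← sub_sub, hTp.sub_eq]
  refine le_of_forall_pos_sub_le fun ε hε => ?_
  obtain ⟨ψ, hψm, hψp, hψ1, hψi⟩ := exists_dual (p := p) (q := q) hgc hgp
    (ε := Real.pi * ε) (by positivity)
  have hgT : normOn q g = normOn q T := normOn_comp_sub_left hTc hTp q 0
  have hψI : Integrable ψ periodMeasure := by
    have : MemLp ψ p periodMeasure :=
      ⟨hψm.aestronglyMeasurable, hψ1.trans_lt ENNReal.one_lt_top⟩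
    exact this.integrable hpq.one_le
  have hψsm : Measurable fun t => ψ (t + s) := hψm.comp (by fun_prop)
  have hψs1 : eLpNorm (fun t => ψ (t + s)) p periodMeasure ≤ 1 := by
    rwa [eLpNorm_comp_add_of_periodic hψm.stronglyMeasurable hψp]
  have hψsI : Integrable (fun t => ψ (t + s)) periodMeasure := by
    have : MemLp (fun t => ψ (t + s)) p periodMeasure :=
      ⟨hψsm.aestronglyMeasurable, hψs1.trans_lt ENNReal.one_lt_top⟩
    exact this.integrable hpq.one_le
  set φ : ℝ → ℝ := fun t => 1 / 2 * (ψ t - ψ (t + s)) with hφ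
  have hφmem : φ ∈ unitBallZero p := by
    refine ⟨fun t => ?_, ?_, ?_, ?_⟩
    · have e : t + 2 * Real.pi + s = t + s + 2 * Real.pi := by ring
      simp only [hφ]; rw [e, hψp, hψp]
    · exact (measurable_const.mul (hψm.sub hψsm)).aestronglyMeasurable
    · have e : φ = (1 / 2 : ℝ) • (ψ - fun t => ψ (t + s)) := rfl
      rw [periodNorm, e, eLpNorm_const_smul]
      calc ‖(1 / 2 : ℝ)‖ₑ * eLpNorm (ψ - fun t => ψ (t + s)) p periodMeasure
          ≤ ‖(1 / 2 : ℝ)‖ₑ * (1 + 1) := by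
            gcongr
            exact (eLpNorm_sub_le hψm.aestronglyMeasurable hψsm.aestronglyMeasurable
              hpq.one_le).trans (add_le_add hψ1 hψs1)
        _ = 1 := by
            rw [Real.enorm_eq_ofReal (by norm_num), one_add_one_eq_two,
              ← ENNReal.ofReal_ofNat 2, ← ENNReal.ofReal_mul (by norm_num)]
            norm_num
    · rw [integral_period_eq]
      simp only [hφ]
      rw [integral_const_mul, integral_sub hψI hψsI, integral_period_comp_add hψp, sub_self,
        mul_zero]
  set f : ℝ → ℝ := fun x => (0 : ℝ) / 2 + 1 / Real.pi *
    ∫ t in (-Real.pi)..Real.pi, poissonKernel α r β (x - t) * φ t with hf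
  have hfmem : f ∈ poissonClass α r β p := by
    refine ⟨fun x => ?_, 0, φ, hφmem, fun x => rfl⟩
    have e : ∀ t, x + 2 * Real.pi - t = x - t + 2 * Real.pi := fun t => by ring
    simp only [hf, e, periodic_poissonKernel α r β _]
  have hdev := sub_fourierSum_eq hα hn hA (integrable_of_mem_unitBallZero hpq.one_le hφmem)
    (f := f) (fun x => rfl) 0
  have hle : |f 0 - fourierSum f (n - 1) 0| ≤ (fourierDeviation α r β p n).toReal := by
    rw [← Real.norm_eq_abs, ← toReal_enorm]
    refine ENNReal.toReal_mono hfin ?_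
    exact (le_iSup (fun x => ‖f x - fourierSum f (n - 1) x‖ₑ) 0).trans
      (le_iSup₂ (f := fun f (_ : f ∈ poissonClass α r β p) =>
        uniformNorm fun x => f x - fourierSum f (n - 1) x) f hfmem)
  have hgs : Continuous fun t => g t + g (t - s) := by fun_prop
  have hgI : ∀ {h u : ℝ → ℝ}, Continuous h → Function.Periodic h (2 * Real.pi) →
      Integrable u periodMeasure → Integrable (fun t => h t * u t) periodMeasure :=
    fun {h u} hc hp hu => hu.bdd_mul (c := normOn ∞ h) hc.aestronglyMeasurable
      (Filter.Eventually.of_forall (norm_le_normOn_top hc hp))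
  have hgsp : Function.Periodic (fun t => g (t - s)) (2 * Real.pi) := fun t => by
    have e : t + 2 * Real.pi - s = t - s + 2 * Real.pi := by ring
    simp only [e]; exact hgp _
  have hgsc : Continuous fun t => g (t - s) := by fun_prop
  have hint : ∫ t, T (0 - t) * φ t ∂periodMeasure =
      ∫ t, g t * ψ t ∂periodMeasure -
        1 / 2 * ∫ t, (g t + g (t - s)) * ψ t ∂periodMeasure := by
    have h1 : ∫ t, g t * ψ (t + s) ∂periodMeasure = ∫ t, g (t - s) * ψ t ∂periodMeasure := by
      have h := integral_period_comp_add (f := fun t => g (t - s) * ψ t)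
        (fun t => by
          have := hgsp t
          simp only at this
          simp only [this, hψp t]) s
      simpa only [add_sub_cancel_right] using h
    have h2 : ∀ t, T (0 - t) * φ t = 1 / 2 * (g t * ψ t - g t * ψ (t + s)) := fun t => by
      simp only [hg, hφ]; ring
    simp_rw [h2, add_mul]
    rw [integral_const_mul, integral_sub (hgI hgc hgp hψI) (hgI hgc hgp hψsI), h1,
      integral_add (hgI hgc hgp hψI) (hgI hgsc hgsp hψI)]
    ring
  have hH := abs_integral_mul_le_normOn (p := p) (q := q) hgs hψm.aestronglyMeasurable hψ1
  have hnorm : normOn q (fun t => g t + g (t - s)) = normOn q (fun t => T t + T (t + s)) := by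
    rw [← normOn_comp_sub_left (f := fun t => T t + T (t + s)) (by fun_prop) (fun t => by
      have e : t + 2 * Real.pi + s = t + s + 2 * Real.pi := by ring
      simp only [e, hTp _]) q 0]
    congr 1; ext t
    simp only [hg]
    congr 2; ring
  rw [hnorm] at hH
  rw [hdev, hint] at hle
  have h3 := (le_abs_self _).trans hle
  have h4 := (abs_le.1 hH).2
  rw [hgT] at hψi
  have h5 : 1 / Real.pi * (normOn q T - Real.pi * ε -
      1 / 2 * normOn q (fun t => T t + T (t + s))) ≤ 1 / Real.pi *
      (∫ t, g t * ψ t ∂periodMeasure -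
        1 / 2 * ∫ t, (g t + g (t - s)) * ψ t ∂periodMeasure) := by
    gcongr
  have h6 : 1 / Real.pi * (normOn q T - Real.pi * ε -
      1 / 2 * normOn q (fun t => T t + T (t + s))) = 1 / Real.pi * (normOn q T -
      1 / 2 * normOn q (fun t => T t + T (t + s))) - ε := by
    field_simp; ring
  linarith

lemma normOn_tailKernel (α r β : ℝ) (n : ℕ) (q : ℝ≥0∞) :
    normOn q (tailKernel α r β n) = Real.exp (-α * (n : ℝ) ^ r) *
      normOn q (phasePart n (remainderSeries α r n) (-(β * Real.pi / 2))) := by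
  have := normOn_const_mul q (Real.exp (-α * (n : ℝ) ^ r))
    (phasePart n (remainderSeries α r n) (-(β * Real.pi / 2)))
  rwa [abs_of_pos (Real.exp_pos _)] at this

/-- A shift by π / n adds π to the phase and reverses the sign of the oscillation, so the sum sees
only the variation of the remainder series. -/
lemma normOn_tailKernel_add_shift_le (hα : 0 < α) (hn : 1 ≤ n)
    (hA : 2 ≤ α * r * (n : ℝ) ^ r) {D : ℝ} (hD : ShiftBound q n (remainderSeries α r n) D) :
    normOn q (fun t => tailKernel α r β n t + tailKernel α r β n (t + Real.pi / n)) ≤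
      Real.exp (-α * (n : ℝ) ^ r) * D := by
  have hF := continuous_remainderSeries hα hn hA
  have hn0 : (0 : ℝ) < n := by exact_mod_cast hn
  set c := Real.exp (-α * (n : ℝ) ^ r) with hc
  have hc0 : 0 < c := Real.exp_pos _
  have h1 := normOn_const_mul q c
    (fun t => ‖remainderSeries α r n (t + Real.pi / n) - remainderSeries α r n t‖)
  rw [normOn_norm q (fun t => remainderSeries α r n (t + Real.pi / n) - remainderSeries α r n t),
    abs_of_pos hc0] at h1
  have h2 := hD (Real.pi / n) (abs_of_pos (by positivity)).le
  refine le_trans ?_ (mul_le_mul_of_nonneg_left h2 hc0.le)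
  rw [← h1]
  refine normOn_mono (memLp_of_continuous (by fun_prop) q) fun t _ => ?_
  have h3 := abs_phasePart_sub_shift_le hn (remainderSeries α r n) (-(β * Real.pi / 2)) Real.pi t
  have h4 : phasePart n (remainderSeries α r n) (-(β * Real.pi / 2) + Real.pi) t =
      -phasePart n (remainderSeries α r n) (-(β * Real.pi / 2)) t := by
    rw [phasePart_eq_norm_mul_cos, phasePart_eq_norm_mul_cos, add_right_comm, Real.cos_add_pi]
    ring
  rw [h4, ← abs_neg, neg_sub, sub_neg_eq_add, add_comm] at h3
  rw [tailKernel, tailKernel, ← hc, ← mul_add, norm_mul, Real.norm_eq_abs, Real.norm_eq_abs,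
    Real.norm_eq_abs, abs_of_pos hc0, abs_of_nonneg (mul_nonneg hc0.le (norm_nonneg _))]
  gcongr

lemma abs_toReal_fourierDeviation_sub_le (hα : 0 < α) (hr₀ : 0 < r) (hr₁ : r < 1) (hn : 1 ≤ n)
    (hA : 2 ≤ α * r * (n : ℝ) ^ r) (ha₁ : α * r * (n : ℝ) ^ r / n ≤ 1 / 14)
    [hpq : ENNReal.HolderConjugate p q] :
    |(fourierDeviation α r β p n).toReal - Real.exp (-α * (n : ℝ) ^ r) *
      (1 / Real.pi * (normOn q Real.cos / (2 * Real.pi) ^ (1 / q).toReal *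
        normOn q (cauchyKernel (α * r * (n : ℝ) ^ r / n))))| ≤
      Real.exp (-α * (n : ℝ) ^ r) * (28 + 14 / (α * r * (n : ℝ) ^ r) *
        normOn q (cauchyKernel (α * r * (n : ℝ) ^ r / n))) := by
  have hq : 1 ≤ q := hpq.symm.one_le
  have hpi := Real.pi_pos
  have hF := continuous_remainderSeries hα hn hA
  have hD := normOn_remainderSeries_shift_le hα hr₀ hr₁ hn hA ha₁ hq
  have hup := ENNReal.toReal_mono ENNReal.ofReal_ne_top
    (fourierDeviation_le (β := β) hα hn hA (p := p) (q := q))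
  have hlow := le_toReal_fourierDeviation (β := β) hα hn hA (p := p) (q := q) (Real.pi / n)
  have hshift := normOn_tailKernel_add_shift_le (β := β) hα hn hA hD
  have hphase := abs_normOn_phasePart_sub_le hq hn hF (periodic_remainderSeries α r n) hD
    (-(β * Real.pi / 2))
  have hFH := abs_normOn_remainderSeries_sub_le hα hr₀ hr₁ hn hA ha₁ hq
  rw [ENNReal.toReal_ofReal (mul_nonneg (by positivity) (normOn_nonneg _ _))] at hup
  rw [normOn_tailKernel] at hup hlow
  set A := α * r * (n : ℝ) ^ r
  set h := normOn q (cauchyKernel (A / n))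
  set c := Real.exp (-α * (n : ℝ) ^ r)
  set X := normOn q (phasePart n (remainderSeries α r n) (-(β * Real.pi / 2)))
  set κ := normOn q Real.cos / (2 * Real.pi) ^ (1 / q).toReal with hκ
  set E := (fourierDeviation α r β p n).toReal
  have hc0 : 0 < c := Real.exp_pos _
  have hh0 : 0 ≤ h := normOn_nonneg _ _
  have hA0 : 0 < A := by linarith
  have hκ0 : 0 ≤ κ := div_nonneg (normOn_nonneg _ _) (by positivity)
  have hκ1 : κ ≤ 1 := by
    rw [hκ, div_le_one (by positivity)]; exact normOn_cos_le hq
  have h1 : |κ * normOn q (remainderSeries α r n) - κ * h| ≤ 16 * Real.pi + 4 / A * h := by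
    rw [← mul_sub, abs_mul, abs_of_nonneg hκ0]
    exact (mul_le_of_le_one_left (abs_nonneg _) hκ1).trans hFH
  have hup' : Real.pi * E ≤ c * X := by
    have := mul_le_mul_of_nonneg_left hup hpi.le
    rwa [← mul_assoc, mul_one_div_cancel hpi.ne', one_mul] at this
  have hlow' : c * X - 1 / 2 * (c * (8 * Real.pi + 24 / A * h)) ≤ Real.pi * E := by
    have := mul_le_mul_of_nonneg_left hlow hpi.le
    rw [← mul_assoc, mul_one_div_cancel hpi.ne', one_mul] at this
    linarith
  -- Phase averaging contributes 8π + 24h/A, and the passage from the remainder series to the Cauchy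
  -- kernel 16π + 4h/A.
  have hX : |c * X - c * (κ * h)| ≤ c * (24 * Real.pi + 28 / A * h) := by
    rw [← mul_sub, abs_mul, abs_of_pos hc0]
    gcongr
    have := abs_sub_le X (κ * normOn q (remainderSeries α r n)) (κ * h)
    have e : 28 / A * h = 24 / A * h + 4 / A * h := by ring
    linarith
  obtain ⟨hX1, hX2⟩ := abs_le.1 hX
  -- The mean-zero correction adds half of the shift bound, 4π + 12h/A.
  have hkey : |Real.pi * E - c * (κ * h)| ≤ c * (28 * Real.pi + 40 / A * h) := by
    have e : c * (28 * Real.pi + 40 / A * h) = c * (24 * Real.pi + 28 / A * h) +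
      1 / 2 * (c * (8 * Real.pi + 24 / A * h)) := by ring
    have e0 : 0 ≤ c * (8 * Real.pi + 24 / A * h) := by positivity
    rw [abs_le]; constructor <;> linarith
  have e : E - c * (1 / Real.pi * (κ * h)) = 1 / Real.pi * (Real.pi * E - c * (κ * h)) := by
    field_simp
  rw [e, abs_mul, abs_of_pos (by positivity)]
  calc 1 / Real.pi * |Real.pi * E - c * (κ * h)|
      ≤ 1 / Real.pi * (c * (28 * Real.pi + 40 / A * h)) := by gcongr
    _ = c * (28 + (40 / Real.pi) / A * h) := by field_simp
    _ ≤ c * (28 + 14 / A * h) := by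
        gcongr
        rw [div_le_iff₀ hpi]; linarith [Real.pi_gt_three]

end Deviation

/-! ### Consequences of n ≥ n₀ -/

lemma threshold_pos {p : ℝ≥0∞} (hp : 1 ≤ p) : 0 < threshold p := by
  unfold threshold
  have := Real.pi_pos
  split_ifs with h1 h2
  · norm_num
  · positivity
  · have h3 : 1 < p.toReal := by
      rw [← ENNReal.toReal_one]
      exact ENNReal.toReal_strict_mono h2 (lt_of_le_of_ne hp (Ne.symm h1))
    have h4 : 0 < (p.toReal - 1) / p.toReal := div_pos (by linarith) (by linarith)
    positivity

lemma threshold_le {p : ℝ≥0∞} (hp : 1 ≤ p) : threshold p ≤ 1 / 14 := by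
  unfold threshold
  have h0 : 1 / (3 * Real.pi) ^ 3 ≤ (1 : ℝ) / 14 := by
    gcongr
    have h9 : (9 : ℝ) ≤ 3 * Real.pi := by linarith [Real.pi_gt_three]
    calc (14 : ℝ) ≤ 9 ^ 3 := by norm_num
      _ ≤ _ := by gcongr
  split_ifs with h1 h2
  · exact le_rfl
  · exact h0
  · refine le_trans (mul_le_of_le_one_right (by positivity) ?_) h0
    have h3 : 1 < p.toReal := by
      rw [← ENNReal.toReal_one]
      exact ENNReal.toReal_strict_mono h2 (lt_of_le_of_ne hp (Ne.symm h1))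
    rw [div_le_one (by linarith)]; linarith

lemma one_le_chi {p : ℝ≥0∞} (hp : 1 ≤ p) : 1 ≤ chi p := by
  unfold chi
  split_ifs with h
  · exact le_rfl
  · rw [← ENNReal.toReal_one]; exact ENNReal.toReal_mono h hp

/-- Both summands in the condition defining n₀ are nonnegative and decrease in n, so each stays
below 1/14 from n₀ on; χ(p) ≥ 1 may be dropped. -/
lemma bounds_of_n₀_le {α r : ℝ} {p : ℝ≥0∞} (hr₀ : 0 < r) (hr₁ : r < 1) (hα : 0 < α)
    (hp : 1 ≤ p) {n : ℕ} (hn : n₀ α r p ≤ n) :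
    1 ≤ n ∧ 14 ≤ α * r * (n : ℝ) ^ r ∧ α * r * (n : ℝ) ^ r / n ≤ 1 / 14 := by
  -- Without nonemptiness `sInf` would take the default value 0 and carry no information.
  have hne : {n : ℕ | 1 ≤ n ∧
      1 / (α * r) * (1 / (n : ℝ) ^ r) + α * r * chi p / (n : ℝ) ^ (1 - r) ≤
        threshold p}.Nonempty := by
    have h1 : Filter.Tendsto (fun n : ℕ => (n : ℝ) ^ r) Filter.atTop Filter.atTop :=
      (tendsto_rpow_atTop hr₀).comp tendsto_natCast_atTop_atTop
    have h2 : Filter.Tendsto (fun n : ℕ => (n : ℝ) ^ (1 - r)) Filter.atTop Filter.atTop :=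
      (tendsto_rpow_atTop (by linarith)).comp tendsto_natCast_atTop_atTop
    have h3 := ((h1.const_div_atTop 1).const_mul (1 / (α * r))).add
      (h2.const_div_atTop (α * r * chi p))
    rw [mul_zero, add_zero] at h3
    obtain ⟨m, hm1, hm2⟩ := ((h3.eventually_le_const (threshold_pos hp)).and
      (Filter.eventually_ge_atTop 1)).exists
    exact ⟨m, hm2, hm1⟩
  obtain ⟨hm1, hm2⟩ := Nat.sInf_mem hne
  rw [← n₀] at hm1 hm2
  set m := n₀ α r p
  have hm0 : (0 : ℝ) < m := by exact_mod_cast hm1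
  have hmn : (m : ℝ) ≤ n := by exact_mod_cast hn
  have hn0 : (0 : ℝ) < n := by linarith
  have hαr : 0 < α * r := mul_pos hα hr₀
  have hchi := one_le_chi hp
  have hlast := hm2.trans (threshold_le hp)
  have hx : 0 ≤ 1 / (α * r) * (1 / (m : ℝ) ^ r) := by positivity
  have hy : 0 ≤ α * r * chi p / (m : ℝ) ^ (1 - r) := by positivity
  refine ⟨hm1.trans hn, ?_, ?_⟩
  · have h1 : 1 / (α * r) * (1 / (n : ℝ) ^ r) ≤ 1 / (α * r) * (1 / (m : ℝ) ^ r) := by gcongr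
    have h2 : 1 / (α * r * (n : ℝ) ^ r) ≤ 1 / 14 := by
      rw [one_div_mul_one_div] at h1; linarith
    exact (one_div_le_one_div (by positivity) (by norm_num)).1 h2
  · have e : α * r * (n : ℝ) ^ r / n = α * r / (n : ℝ) ^ (1 - r) := by
      rw [Real.rpow_sub hn0, Real.rpow_one]; field_simp
    rw [e]
    calc α * r / (n : ℝ) ^ (1 - r) ≤ α * r * chi p / (m : ℝ) ^ (1 - r) := by
          exact div_le_div₀ (by positivity) (le_mul_of_one_le_right hαr.le hchi) (by positivity)
            (Real.rpow_le_rpow hm0.le hmn (by linarith))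
      _ ≤ 1 / 14 := by linarith

end FourierPoisson

/-! ### The asymptotic formula -/

theorem theorem1 (α r β : ℝ) (p p' : ℝ≥0∞) (hr₀ : 0 < r) (hr₁ : r < 1) (hα : 0 < α)
    (hp : 1 ≤ p) (hpp' : 1 / p + 1 / p' = 1) (n : ℕ) (hn : FourierPoisson.n₀ α r p ≤ n) :
    FourierPoisson.fourierDeviation α r β p n ≠ ∞ ∧
    ∃ γ : ℝ, |γ| ≤ (14 * Real.pi) ^ 2 ∧
      (FourierPoisson.fourierDeviation α r β p n).toReal =
        Real.exp (-α * (n : ℝ) ^ r) * (n : ℝ) ^ ((1 - r) * (1 / p).toReal) *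
          ((FourierPoisson.periodNorm p' Real.cos).toReal /
                (Real.pi ^ (1 + (1 / p').toReal) * (α * r) ^ (1 / p).toReal) *
              FourierPoisson.J p' (Real.pi * (n : ℝ) ^ (1 - r) / (α * r)) +
            γ * (1 / (α * r) ^ (1 + (1 / p).toReal) *
                  FourierPoisson.J p' (Real.pi * (n : ℝ) ^ (1 - r) / (α * r)) *
                  (1 / (n : ℝ) ^ r) +
                1 / (n : ℝ) ^ ((1 - r) * (1 / p).toReal))) := by
  open FourierPoisson in
  obtain ⟨hn1, hA14, ha₁⟩ := bounds_of_n₀_le hr₀ hr₁ hα hp hn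
  have hA : 2 ≤ α * r * (n : ℝ) ^ r := by linarith
  have hpq : ENNReal.HolderConjugate p p' := by
    rw [ENNReal.holderConjugate_iff]; simpa using hpp'
  have hn0 : (0 : ℝ) < n := by exact_mod_cast hn1
  have hpi := Real.pi_pos
  have hαr : 0 < α * r := mul_pos hα hr₀
  refine ⟨((fourierDeviation_le hα hn1 hA (q := p')).trans_lt ENNReal.ofReal_lt_top).ne, ?_⟩
  have hmain := abs_toReal_fourierDeviation_sub_le (β := β) hα hr₀ hr₁ hn1 hA ha₁
    (p := p) (q := p')
  have hcos : (periodNorm p' Real.cos).toReal = normOn p' Real.cos := rfl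
  rw [hcos]
  have hp'1 : 1 ≤ p' := hpq.symm.one_le
  have hQ1 := toReal_one_div_le_one hp'1
  have hPQ : (1 / p).toReal + (1 / p').toReal = 1 := by
    rw [← ENNReal.toReal_add (ne_top_of_le_ne_top ENNReal.one_ne_top (by simpa using hp))
      (ne_top_of_le_ne_top ENNReal.one_ne_top (by simpa using hp'1)), hpp', ENNReal.toReal_one]
  rw [normOn_cauchyKernel (by positivity)] at hmain
  set P := (1 / p).toReal
  set Q := (1 / p').toReal
  have hv : Real.pi / (α * r * (n : ℝ) ^ r / n) = Real.pi * (n : ℝ) ^ (1 - r) / (α * r) := by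
    rw [Real.rpow_sub hn0, Real.rpow_one]; field_simp
  rw [hv] at hmain
  set j := J p' (Real.pi * (n : ℝ) ^ (1 - r) / (α * r))
  have hj0 : 0 ≤ j := ENNReal.toReal_nonneg
  have haP : (α * r * (n : ℝ) ^ r / n) ^ (Q - 1) = (n : ℝ) ^ ((1 - r) * P) / (α * r) ^ P := by
    have e : α * r * (n : ℝ) ^ r / n = α * r / (n : ℝ) ^ (1 - r) := by
      rw [Real.rpow_sub hn0, Real.rpow_one]; field_simp
    have e2 : Q - 1 = -P := by linarith
    rw [e, e2, Real.rpow_neg (by positivity), Real.div_rpow hαr.le (by positivity),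
      ← Real.rpow_mul hn0.le, inv_div]
  rw [haP] at hmain
  set w := (n : ℝ) ^ ((1 - r) * P) with hw
  have hw0 : 0 < w := by positivity
  set N := w / (α * r) ^ P * j with hN
  have hN0 : 0 ≤ N := by positivity
  set A := α * r * (n : ℝ) ^ r with hAdef
  have hA0 : 0 < A := by linarith
  set c := Real.exp (-α * (n : ℝ) ^ r)
  have hc0 : 0 < c := Real.exp_pos _
  set E := (fourierDeviation α r β p n).toReal
  set M := 1 / Real.pi * (normOn p' Real.cos / (2 * Real.pi) ^ Q * (2 ^ Q * N)) with hM
  have hden : 0 < N / A + 1 := by positivity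
  -- The required identity, after w is multiplied in, reads E / c = M + γ (N / A + 1), and γ is its
  -- solution. Since 2^Q ≤ 2, the total error is at most 28 (N / A + 1), well within (14π)².
  refine ⟨(E / c - M) / (N / A + 1), ?_, ?_⟩
  · have h2Q : (2 : ℝ) ^ Q ≤ 2 := by
      calc (2 : ℝ) ^ Q ≤ 2 ^ (1 : ℝ) := Real.rpow_le_rpow_of_exponent_le (by norm_num) hQ1
        _ = 2 := Real.rpow_one _
    have h1 : E / c - M = (E - c * M) / c := by field_simp
    rw [abs_div, abs_of_pos hden, div_le_iff₀ hden, h1, abs_div, abs_of_pos hc0,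
      div_le_iff₀ hc0]
    refine hmain.trans ?_
    rw [mul_comm c]
    gcongr
    have h2 : 14 / A * (2 ^ Q * N) ≤ 14 / A * (2 * N) := by gcongr
    have h3 : 14 / A * (2 * N) = 28 * (N / A) := by ring
    have h4 : (28 : ℝ) ≤ (14 * Real.pi) ^ 2 := by nlinarith [Real.pi_gt_three]
    calc 28 + 14 / A * (2 ^ Q * N) ≤ 28 * (N / A + 1) := by linarith
      _ ≤ _ := by gcongr
  -- The 2^Q from the evenness of the Cauchy kernel cancels against the (2π)^Q from phase averaging.
  · have e1 : w * (normOn p' Real.cos / (Real.pi ^ (1 + Q) * (α * r) ^ P) * j) = M := by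
      rw [hM, hN, Real.rpow_add hpi, Real.rpow_one, Real.mul_rpow (by norm_num) hpi.le]
      field_simp
    have e2 : w * (1 / (α * r) ^ (1 + P) * j * (1 / (n : ℝ) ^ r) + 1 / w) = N / A + 1 := by
      rw [hN, hAdef, Real.rpow_add hαr, Real.rpow_one]
      field_simp
    have e3 : ∀ x y z : ℝ, c * w * (x + z * y) = c * (w * x + z * (w * y)) := fun x y z => by ring
    rw [e3, e1, e2, div_mul_cancel₀ _ hden.ne']
    field_simp
    ring
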